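/- **Setting.** *Session types* are $A,B ::= 1 \mid \oplus\{\ell{:}A_\ell\}_{\ell\in L}\mid \&\{\ell{:}A_\ell\}_{\ell\in L}\mid A\otimes B\mid A\multimap B\mid Y$ with $L$ a finite set of labels. A signature $\Sigma$ consists of type definitions $Y=A$ and process definitions $\Omega\vdash X=P::x{:}A$; it is well formed if every type definition is contractive ($A$ is not a type variable) and every process body is well typed. Types are equi-recursive: types with the same infinite unfolding are interchangeable. $1,\oplus,\otimes$ are positive and $\&,\multimap$ negative, after unfolding. Process terms are $\mathbf{close}\,x$, $\mathbf{wait}\,x;Q$, $x.k;P$, $\mathbf{case}\,x(\ell\Rightarrow Q_\ell)_{\ell\in L}$, $\mathbf{send}\,z\,x;P$, $z\leftarrow\mathbf{recv}\,x;P$, $(x\leftarrow X[\gamma]\leftarrow\Omega);Q$ and forwarder calls $F_Y[y\leftarrow z]$ (where $F_Y$ is the identity expansion of the definition of $Y$), typed by the usual rules $\Omega\vdash_\Sigma P::x{:}A$ of the intuitionistic linear sequent calculus. Channels $y_\alpha$ have a base $y$ and a generation $\alpha\in\mathbb N$. A configuration is a multiset of processes $\mathbf{proc}(y_\alpha,P)$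 (providing $y_\alpha$) and messages $\mathbf{msg}(M)$, $M ::= \mathbf{close}\,y_\alpha\mid y_\alpha.k\mid\mathbf{send}\,z_\beta\,y_\alpha$. The judgment $\Delta\Vdash\mathcal D::\Delta'$ is generated by the empty configurations $x_\alpha{:}A\Vdash\cdot::x_\alpha{:}A$ and $\cdot\Vdash\cdot::\cdot$, by juxtaposition of configurations, and by placing one process or message, typed by its term or message rule, on top of a forest of configurations providing channels it uses; its other channels are free and belong to $\Delta$. Contexts are linear and bound channels are named apart from one another and from free ones. By the naming convention for generations, if $y_\alpha,y_{\alpha'}$ with $\alpha<\alpha'$ both occur in $\mathcal D$ or its interface, then $\mathcal D$ contains a message $y_\alpha.k$ or $\mathbf{send}\,z_\beta\,y_\alpha$ linking $y_\alpha$ to $y_{\alpha+1}$. We write $\mathcal D\in\mathrm{Tree}(\Delta\Vdash K)$, $K=x_\alpha{:}A$, if $\Delta\Vdash\mathcal D::K$ and this convention holds. The dynamics $\mapsto$ is asynchronous multiset rewriting: a process sending along $y_\alpha$ emits a message and continues with $y_{\alpha+1}$ for $y_\alpha$ (close terminates it); a process receiving along $y_\alpha$ consumes the message and continues likewise with $y_{\alpha+1}$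 (and, for $\mathbf{send}\,x_\beta\,y_\alpha$, with $x_\beta$ for the bound variable); after $\mathbf{close}\,y_\alpha$ the waiting process continues unchanged; a spawn creates a process at $x_0$ with fresh base $x$; $\mathbf{proc}(y_\alpha,F_Y[y_\alpha\leftarrow x_\beta])$ unfolds the forwarder. $\mapsto^{*_{\Upsilon;\Theta}}$ is zero or more steps up to renaming the bases of bound channels, where $\Upsilon$ and $\Theta$ are the sets of interface channels along which the resulting configuration contains a message to be sent, respectively a process waiting to receive. $\mathbf{Out}(\Delta\Vdash K)$ consists of the positive channel of $K$ and the negative channels of $\Delta$, $\mathbf{In}(\Delta\Vdash K)$ of the negative channel of $K$ and the positive channels of $\Delta$. **Logical relation.** $(\mathcal D_1;\mathcal D_2)\in\mathcal E[\![\Delta\Vdash K]\!]^0$ iff $\mathcal D_1,\mathcal D_2\in\mathrm{Tree}(\Delta\Vdash K)$. $(\mathcal D_1;\mathcal D_2)\in\mathcal E[\![\Delta\Vdash K]\!]^{m+1}$ iff $\mathcal D_1,\mathcal D_2\in\mathrm{Tree}(\Delta\Vdash K)$ and whenever $\mathcal D_1\mapsto^{*_{\Upsilon_1;\Theta_1}}\mathcal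 D_1'$ there are $\Upsilon_2,\mathcal D_2'$ with $\mathcal D_2\mapsto^{*_{\Upsilon_2}}\mathcal D_2'$, $\Upsilon_1\subseteq\Upsilon_2$, $(\mathcal D_1';\mathcal D_2')\in\mathcal V[\![\Delta\Vdash K]\!]^{m+1}_{\cdot;y_\alpha}$ for all $y_\alpha\in\mathbf{Out}(\Delta\Vdash K)\cap\Upsilon_1$, and $(\mathcal D_1';\mathcal D_2')\in\mathcal V[\![\Delta\Vdash K]\!]^{m+1}_{y_\alpha;\cdot}$ for all $y_\alpha\in\mathbf{In}(\Delta\Vdash K)\cap\Theta_1$. The value relations require both configurations to be in the corresponding $\mathrm{Tree}$ and, by the unfolded type of $y_\alpha$: - $\mathcal V[\![\cdot\Vdash y_\alpha{:}1]\!]_{\cdot;y_\alpha}^{m+1}$: both are $\mathbf{msg}(\mathbf{close}\,y_\alpha)$. - $\mathcal V[\![\Delta\Vdash y_\alpha{:}\oplus\{\ell{:}A_\ell\}_{\ell\in L}]\!]_{\cdot;y_\alpha}^{m+1}$: for some $k\in L$, $\mathcal D_i=\mathcal D_i'\,\mathbf{msg}(y_\alpha.k)$ with $(\mathcal D_1';\mathcal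 D_2')\in\mathcal E[\![\Delta\Vdash y_{\alpha+1}{:}A_k]\!]^m$. - $\mathcal V[\![\Delta\Vdash y_\alpha{:}\&\{\ell{:}A_\ell\}_{\ell\in L}]\!]_{y_\alpha;\cdot}^{m+1}$: for all $k\in L$, $(\mathcal D_1\mathbf{msg}(y_\alpha.k);\mathcal D_2\mathbf{msg}(y_\alpha.k))\in\mathcal E[\![\Delta\Vdash y_{\alpha+1}{:}A_k]\!]^m$. - $\mathcal V[\![\Delta',\Delta''\Vdash y_\alpha{:}A\otimes B]\!]_{\cdot;y_\alpha}^{m+1}$: for some $x_\beta$, $\mathcal D_i=\mathcal D_i'\,\mathcal T_i\,\mathbf{msg}(\mathbf{send}\,x_\beta\,y_\alpha)$ with $\mathcal T_i\in\mathrm{Tree}(\Delta''\Vdash x_\beta{:}A)$, $(\mathcal T_1;\mathcal T_2)\in\mathcal E[\![\Delta''\Vdash x_\beta{:}A]\!]^m$ and $(\mathcal D_1';\mathcal D_2')\in\mathcal E[\![\Delta'\Vdash y_{\alpha+1}{:}B]\!]^m$. - $\mathcal V[\![\Delta\Vdash y_\alpha{:}A\multimap B]\!]_{y_\alpha;\cdot}^{m+1}$: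 for all fresh $x_\beta$, $(\mathcal D_1\mathbf{msg}(\mathbf{send}\,x_\beta\,y_\alpha);\mathcal D_2\mathbf{msg}(\mathbf{send}\,x_\beta\,y_\alpha))\in\mathcal E[\![\Delta,x_\beta{:}A\Vdash y_{\alpha+1}{:}B]\!]^m$. - For $y_\alpha$ on the left the dual clauses: $\mathcal V[\![\Delta,y_\alpha{:}T\Vdash K]\!]_{y_\alpha;\cdot}^{m+1}$ adds to both configurations $\mathbf{msg}(\mathbf{close}\,y_\alpha)$ ($T=1$), every $\mathbf{msg}(y_\alpha.k)$ with $k\in L$ ($T=\oplus\{\ell{:}A_\ell\}_{\ell\in L}$), or every $\mathbf{msg}(\mathbf{send}\,x_\beta\,y_\alpha)$ with $x_\beta$ fresh ($T=A\otimes B$), and requires the results to be in $\mathcal E[\![\Delta\Vdash K]\!]^m$, $\mathcal E[\![\Delta,y_{\alpha+1}{:}A_k\Vdash K]\!]^m$, $\mathcal E[\![\Delta,x_\beta{:}A,y_{\alpha+1}{:}B\Vdash K]\!]^m$, respectively; $\mathcal V[\![\Delta,y_\alpha{:}\&\{\ell{:}A_\ell\}_{\ell\in L}\Vdash K]\!]_{\cdot;y_\alpha}^{m+1}$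 requires $\mathcal D_i=\mathbf{msg}(y_\alpha.k)\mathcal D_i'$ for some $k\in L$ with $(\mathcal D_1';\mathcal D_2')\in\mathcal E[\![\Delta,y_{\alpha+1}{:}A_k\Vdash K]\!]^m$; and $\mathcal V[\![\Delta',\Delta'',y_\alpha{:}A\multimap B\Vdash K]\!]_{\cdot;y_\alpha}^{m+1}$ requires, for some $x_\beta$, $\mathcal D_i=\mathcal T_i\,\mathbf{msg}(\mathbf{send}\,x_\beta\,y_\alpha)\,\mathcal D_i'$ with $\mathcal T_i\in\mathrm{Tree}(\Delta'\Vdash x_\beta{:}A)$, $(\mathcal T_1;\mathcal T_2)\in\mathcal E[\![\Delta'\Vdash x_\beta{:}A]\!]^m$ and $(\mathcal D_1';\mathcal D_2')\in\mathcal E[\![\Delta'',y_{\alpha+1}{:}B\Vdash K]\!]^m$. Here *fresh* means that the base $x$ occurs neither in the interface nor in $\mathcal D_1,\mathcal D_2$. *Logical equivalence* $(\Delta\Vdash\mathcal D_1::K)\equiv(\Delta\Vdash\mathcal D_2::K)$ means that $\mathcal D_1,\mathcal D_2\in\mathrm{Tree}(\Delta\Vdash K)$ and, for all $m$, $(\mathcal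 D_1;\mathcal D_2)\in\mathcal E[\![\Delta\Vdash K]\!]^m$ and $(\mathcal D_2;\mathcal D_1)\in\mathcal E[\![\Delta\Vdash K]\!]^m$. **Lemma (Reflexivity).** Let $\Sigma$ be a well-formed signature. For every well-typed configuration $\Delta\Vdash\mathcal D::x_\alpha{:}T$ that respects the naming convention for generations, $(\Delta\Vdash\mathcal D::x_\alpha{:}T)\equiv(\Delta\Vdash\mathcal D::x_\alpha{:}T)$. -/

import Mathlib

namespace RSLR

/-! ## Channels, session types, process terms -/

/-- A run-time channel `y_α`: a base name `y` together with a generation `α`. -/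
structure Chan where
  base : ℕ
  gen : ℕ
deriving DecidableEq

/-- The next generation `y_{α+1}` of the channel `y_α`. -/
def Chan.next (y : Chan) : Chan := ⟨y.base, y.gen + 1⟩

/-- Session types over labels `Lab` and type variables `TN`. In a choice over the finite label
set `L` only the components `A ℓ` with `ℓ ∈ L` are meaningful. -/
inductive Ty (Lab TN : Type) : Type
  | one : Ty Lab TN
  | plus (L : Finset Lab) (A : Lab → Ty Lab TN) : Ty Lab TN
  | amp (L : Finset Lab) (A : Lab → Ty Lab TN) : Ty Lab TN
  | tensor (A B : Ty Lab TN) : Ty Lab TN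
  | lolli (A B : Ty Lab TN) : Ty Lab TN
  | var (Y : TN) : Ty Lab TN

/-- Process terms whose free channel names are drawn from `V`. A binder extends the set of names
to `Option V`, the bound name being `none`; so terms are identified up to renaming of bound
variables. `ar X` is the number of channel arguments of the process definition `X`.
* `close x`, `wait x Q`: `close x` and `wait x; Q`
* `sel x k P`, `case x L Q`: `x.k; P` and `case x (ℓ ⇒ Q ℓ)_{ℓ ∈ L}`
* `send z x P`, `recv x P`: `send z x; P` and `z ← recv x; P` (binding `z`)
* `spawn X γ Q`: `(x ← X[γ] ← γ's arguments); Q` (binding `x` in `Q`)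
* `fwd Y y z`: the forwarder call `F_Y[y ← z]`. -/
inductive Proc (Lab TN : Type) {PN : Type} (ar : PN → ℕ) : Type → Type 1
  | close {V : Type} (x : V) : Proc Lab TN ar V
  | wait {V : Type} (x : V) (Q : Proc Lab TN ar V) : Proc Lab TN ar V
  | sel {V : Type} (x : V) (k : Lab) (P : Proc Lab TN ar V) : Proc Lab TN ar V
  | case {V : Type} (x : V) (L : Finset Lab) (Q : Lab → Proc Lab TN ar V) : Proc Lab TN ar V
  | send {V : Type} (z x : V) (P : Proc Lab TN ar V) : Proc Lab TN ar V
  | recv {V : Type} (x : V) (P : Proc Lab TN ar (Option V)) : Proc Lab TN ar V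
  | spawn {V : Type} (X : PN) (γ : Fin (ar X) → V) (Q : Proc Lab TN ar (Option V)) :
      Proc Lab TN ar V
  | fwd {V : Type} (Y : TN) (y z : V) : Proc Lab TN ar V

/-- Simultaneous (capture-avoiding) substitution of names for free names. -/
def Proc.map {Lab TN PN : Type} {ar : PN → ℕ} :
    {V W : Type} → (V → W) → Proc Lab TN ar V → Proc Lab TN ar W
  | _, _, f, .close x => .close (f x)
  | _, _, f, .wait x Q => .wait (f x) (Q.map f)
  | _, _, f, .sel x k P => .sel (f x) k (P.map f)
  | _, _, f, .case x L Q => .case (f x) L (fun l => (Q l).map f)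
  | _, _, f, .send z x P => .send (f z) (f x) (P.map f)
  | _, _, f, .recv x P => .recv (f x) (P.map (Option.map f))
  | _, _, f, .spawn X γ Q => .spawn X (fun i => f (γ i)) (Q.map (Option.map f))
  | _, _, f, .fwd Y y z => .fwd Y (f y) (f z)

/-- The free names of a process term. -/
def Proc.fn {Lab TN PN : Type} {ar : PN → ℕ} : {V : Type} → Proc Lab TN ar V → Set V
  | _, .close x => {x}
  | _, .wait x Q => {x} ∪ Q.fn
  | _, .sel x _ P => {x} ∪ P.fn
  | _, .case x L Q => {x} ∪ {v | ∃ l ∈ L, v ∈ (Q l).fn}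
  | _, .send z x P => {z, x} ∪ P.fn
  | _, .recv x P => {x} ∪ {v | some v ∈ P.fn}
  | _, .spawn _ γ Q => Set.range γ ∪ {v | some v ∈ Q.fn}
  | _, .fwd _ y z => {y, z}

/-- The substitution `[y_{α+1}/y_α]`. -/
def advance (y : Chan) (c : Chan) : Chan := if c = y then y.next else c

/-- The substitution `[x/w]`, where `w` is the name bound by the outermost binder. -/
def inst {V : Type} (x : V) (o : Option V) : V := o.getD x

/-- The forwarder `y ← x` of type `C`: identity expansion along the structure of `C`, with a call
to `F_Y` at a type variable `Y`. -/
def fwder {Lab TN PN : Type} (ar : PN → ℕ) :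
    Ty Lab TN → {V : Type} → V → V → Proc Lab TN ar V
  | .one, _, y, x => .wait x (.close y)
  | .plus L A, _, y, x => .case x L (fun l => .sel y l (fwder ar (A l) y x))
  | .amp L A, _, y, x => .case y L (fun l => .sel x l (fwder ar (A l) y x))
  | .tensor _ B, _, y, x => .recv x (.send none (some y) (fwder ar B (some y) (some x)))
  | .lolli _ B, _, y, x => .recv y (.send none (some x) (fwder ar B (some y) (some x)))
  | .var Y, _, y, x => .fwd Y y x

/-- A signature: type definitions `Y = tyDef Y`, and process definitions
`(some i : argTy X i)_i ⊢ X = body X :: (none : resTy X)`. The forwarder definitions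
`F_Y = fwder (tyDef Y)` are implicit. -/
structure Sig (Lab TN : Type) {PN : Type} (ar : PN → ℕ) where
  tyDef : TN → Ty Lab TN
  argTy : (X : PN) → Fin (ar X) → Ty Lab TN
  resTy : PN → Ty Lab TN
  body : (X : PN) → Proc Lab TN ar (Option (Fin (ar X)))

section

variable {Lab TN PN : Type} {ar : PN → ℕ}

/-! ## Equi-recursive type equality -/

/-- Unfolding of a type at its head. -/
def Sig.unfold (S : Sig Lab TN ar) : Ty Lab TN → Ty Lab TN
  | .var Y => S.tyDef Y
  | A => A

/-- Two types have the same head connective and `R`-related components. -/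
inductive HeadRel (R : Ty Lab TN → Ty Lab TN → Prop) : Ty Lab TN → Ty Lab TN → Prop
  | one : HeadRel R .one .one
  | plus {L : Finset Lab} {A B : Lab → Ty Lab TN} (h : ∀ l ∈ L, R (A l) (B l)) :
      HeadRel R (.plus L A) (.plus L B)
  | amp {L : Finset Lab} {A B : Lab → Ty Lab TN} (h : ∀ l ∈ L, R (A l) (B l)) :
      HeadRel R (.amp L A) (.amp L B)
  | tensor {A B A' B' : Ty Lab TN} (h₁ : R A A') (h₂ : R B B') :
      HeadRel R (.tensor A B) (.tensor A' B')
  | lolli {A B A' B' : Ty Lab TN} (h₁ : R A A') (h₂ : R B B') :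
      HeadRel R (.lolli A B) (.lolli A' B')

/-- Equi-recursive equality: the types have the same (possibly infinite) unfolding, i.e. they are
related by some bisimulation. -/
def TyEq (S : Sig Lab TN ar) (A B : Ty Lab TN) : Prop :=
  ∃ R : Ty Lab TN → Ty Lab TN → Prop,
    (∀ A B, R A B → HeadRel R (S.unfold A) (S.unfold B)) ∧ R A B

/-- Positive (sending) and negative (receiving) types, determined after unfolding. -/
def Sig.Pos (S : Sig Lab TN ar) (T : Ty Lab TN) : Prop :=
  S.unfold T = .one ∨ (∃ L A, S.unfold T = .plus L A) ∨ ∃ A B, S.unfold T = .tensor A B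

def Sig.Neg (S : Sig Lab TN ar) (T : Ty Lab TN) : Prop :=
  (∃ L A, S.unfold T = .amp L A) ∨ ∃ A B, S.unfold T = .lolli A B

/-! ## Typing of process terms -/

/-- Weakening of the names of a context under a binder. -/
def lift {V : Type} (Ω : Multiset (V × Ty Lab TN)) : Multiset (Option V × Ty Lab TN) :=
  Ω.map (Prod.map some id)

/-- `PTyped S Ω P x A` is `Ω ⊢_S P :: x : A`. Contexts are finite multisets of assumptions; that
the names in `Ω, x : A` are pairwise distinct is imposed where the judgment is used (it then holds
in the whole derivation). The type-variable rules allow replacing a type by any type with the same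
unfolding. -/
inductive PTyped (S : Sig Lab TN ar) :
    {V : Type} → Multiset (V × Ty Lab TN) → Proc Lab TN ar V → V → Ty Lab TN → Prop
  | plusR {V : Type} {Ω : Multiset (V × Ty Lab TN)} {P : Proc Lab TN ar V} {x : V}
      {L : Finset Lab} {A : Lab → Ty Lab TN} {k : Lab} (hk : k ∈ L)
      (hP : PTyped S Ω P x (A k)) : PTyped S Ω (.sel x k P) x (.plus L A)
  | plusL {V : Type} {Ω : Multiset (V × Ty Lab TN)} {Q : Lab → Proc Lab TN ar V} {x y : V}
      {L : Finset Lab} {A : Lab → Ty Lab TN} {C : Ty Lab TN}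
      (hQ : ∀ k ∈ L, PTyped S ((x, A k) ::ₘ Ω) (Q k) y C) :
      PTyped S ((x, .plus L A) ::ₘ Ω) (.case x L Q) y C
  | ampR {V : Type} {Ω : Multiset (V × Ty Lab TN)} {Q : Lab → Proc Lab TN ar V} {x : V}
      {L : Finset Lab} {A : Lab → Ty Lab TN}
      (hQ : ∀ k ∈ L, PTyped S Ω (Q k) x (A k)) : PTyped S Ω (.case x L Q) x (.amp L A)
  | ampL {V : Type} {Ω : Multiset (V × Ty Lab TN)} {P : Proc Lab TN ar V} {x y : V}
      {L : Finset Lab} {A : Lab → Ty Lab TN} {C : Ty Lab TN} {k : Lab} (hk : k ∈ L)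
      (hP : PTyped S ((x, A k) ::ₘ Ω) P y C) :
      PTyped S ((x, .amp L A) ::ₘ Ω) (.sel x k P) y C
  | tensorR {V : Type} {Ω : Multiset (V × Ty Lab TN)} {P : Proc Lab TN ar V} {x z : V}
      {A B : Ty Lab TN} (hP : PTyped S Ω P x B) :
      PTyped S ((z, A) ::ₘ Ω) (.send z x P) x (.tensor A B)
  | tensorL {V : Type} {Ω : Multiset (V × Ty Lab TN)} {P : Proc Lab TN ar (Option V)} {x y : V}
      {A B C : Ty Lab TN}
      (hP : PTyped S ((none, A) ::ₘ (some x, B) ::ₘ lift Ω) P (some y) C) :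
      PTyped S ((x, .tensor A B) ::ₘ Ω) (.recv x P) y C
  | lolliR {V : Type} {Ω : Multiset (V × Ty Lab TN)} {P : Proc Lab TN ar (Option V)} {x : V}
      {A B : Ty Lab TN} (hP : PTyped S ((none, A) ::ₘ lift Ω) P (some x) B) :
      PTyped S Ω (.recv x P) x (.lolli A B)
  | lolliL {V : Type} {Ω : Multiset (V × Ty Lab TN)} {P : Proc Lab TN ar V} {x y z : V}
      {A B C : Ty Lab TN} (hP : PTyped S ((x, B) ::ₘ Ω) P y C) :
      PTyped S ((z, A) ::ₘ (x, .lolli A B) ::ₘ Ω) (.send z x P) y C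
  | oneR {V : Type} {x : V} : PTyped S 0 (.close x) x .one
  | oneL {V : Type} {Ω : Multiset (V × Ty Lab TN)} {Q : Proc Lab TN ar V} {x y : V}
      {C : Ty Lab TN} (hQ : PTyped S Ω Q y C) :
      PTyped S ((x, .one) ::ₘ Ω) (.wait x Q) y C
  | tvarR {V : Type} {Ω : Multiset (V × Ty Lab TN)} {P : Proc Lab TN ar V} {x : V}
      {A B : Ty Lab TN} (hAB : TyEq S A B) (hP : PTyped S Ω P x A) : PTyped S Ω P x B
  | tvarL {V : Type} {Ω : Multiset (V × Ty Lab TN)} {P : Proc Lab TN ar V} {x z : V}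
      {A B C : Ty Lab TN} (hAB : TyEq S A B) (hP : PTyped S ((x, A) ::ₘ Ω) P z C) :
      PTyped S ((x, B) ::ₘ Ω) P z C
  | spawn {V : Type} {Ω : Multiset (V × Ty Lab TN)} {X : PN} {γ : Fin (ar X) → V}
      {Q : Proc Lab TN ar (Option V)} {y : V} {C : Ty Lab TN}
      (hQ : PTyped S ((none, S.resTy X) ::ₘ lift Ω) Q (some y) C) :
      PTyped S (Finset.univ.val.map (fun i => (γ i, S.argTy X i)) + Ω) (.spawn X γ Q) y C
  | dfwd {V : Type} {Y : TN} {y z : V} : PTyped S {(z, .var Y)} (.fwd Y y z) y (.var Y)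

/-- Signature checking: type definitions are contractive (the body of a definition is not itself a
type variable) and the bodies of the process definitions are well typed. -/
structure Sig.WF (S : Sig Lab TN ar) : Prop where
  contr : ∀ Y Z, S.tyDef Y ≠ .var Z
  typed : ∀ X, PTyped S (Finset.univ.val.map (fun i => (some i, S.argTy X i)))
    (S.body X) none (S.resTy X)

/-! ## Configurations -/

/-- Messages `close y`, `y.k` and `send z y`; `y` is the carrier. -/
inductive Msg (Lab : Type) : Type
  | close (y : Chan) : Msg Lab
  | lab (y : Chan) (k : Lab) : Msg Lab
  | send (z y : Chan) : Msg Lab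

def Msg.carrier : Msg Lab → Chan
  | .close y => y
  | .lab y _ => y
  | .send _ y => y

/-- The channels of a message, including the continuation of its carrier. -/
def Msg.chans : Msg Lab → Set Chan
  | .close y => {y}
  | .lab y _ => {y, y.next}
  | .send z y => {z, y, y.next}

def Msg.map (f : Chan → Chan) : Msg Lab → Msg Lab
  | .close y => .close (f y)
  | .lab y k => .lab (f y) k
  | .send z y => .send (f z) (f y)

/-- `proc y P` is a process providing the channel `y` and executing `P`; the names of `P` are
run-time channels, i.e. the substitution of channels for variables has been carried out. -/
inductive Node (Lab TN : Type) {PN : Type} (ar : PN → ℕ) : Type 1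
  | proc (y : Chan) (P : Proc Lab TN ar Chan) : Node Lab TN ar
  | msg (M : Msg Lab) : Node Lab TN ar

def Node.chans : Node Lab TN ar → Set Chan
  | .proc y P => {y} ∪ P.fn
  | .msg M => M.chans

def Node.map (f : Chan → Chan) : Node Lab TN ar → Node Lab TN ar
  | .proc y P => .proc (f y) (P.map f)
  | .msg M => .msg (M.map f)

end

/-- A configuration is a multiset of processes and messages. -/
abbrev Config (Lab TN : Type) {PN : Type} (ar : PN → ℕ) : Type 1 := Multiset (Node Lab TN ar)

/-- Typings of finitely many channels. -/
abbrev Ctx (Lab TN : Type) : Type := Multiset (Chan × Ty Lab TN)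

section

variable {Lab TN PN : Type} {ar : PN → ℕ}

def Config.chans (C : Config Lab TN ar) : Set Chan := {c | ∃ n ∈ C, c ∈ Node.chans n}

def Ctx.dom (Δ : Ctx Lab TN) : Set Chan := {c | ∃ T, (c, T) ∈ Δ}

/-- All channels of `Δ₀ ⊩ C :: Δ`, free or bound. -/
def names (Δ₀ : Ctx Lab TN) (C : Config Lab TN ar) (Δ : Ctx Lab TN) : Set Chan :=
  Ctx.dom Δ₀ ∪ Config.chans C ∪ Ctx.dom Δ

/-- Typing of messages, `Δ ⊢ M :: x : T`, with types taken up to equi-recursive equality. -/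
inductive MTyped (S : Sig Lab TN ar) : Ctx Lab TN → Msg Lab → Chan → Ty Lab TN → Prop
  | plusR {y : Chan} {L : Finset Lab} {A : Lab → Ty Lab TN} {k : Lab} {T U : Ty Lab TN}
      (hT : TyEq S T (.plus L A)) (hU : TyEq S U (A k)) (hk : k ∈ L) :
      MTyped S {(y.next, U)} (.lab y k) y T
  | ampL {y : Chan} {L : Finset Lab} {A : Lab → Ty Lab TN} {k : Lab} {T U : Ty Lab TN}
      (hT : TyEq S T (.amp L A)) (hU : TyEq S U (A k)) (hk : k ∈ L) :
      MTyped S {(y, T)} (.lab y k) y.next U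
  | tensorR {y z : Chan} {T A B : Ty Lab TN} (hT : TyEq S T (.tensor A B)) :
      MTyped S {(z, A), (y.next, B)} (.send z y) y T
  | lolliL {y z : Chan} {T A B : Ty Lab TN} (hT : TyEq S T (.lolli A B)) :
      MTyped S {(z, A), (y, T)} (.send z y) y.next B
  | oneR {y : Chan} {T : Ty Lab TN} (hT : TyEq S T .one) : MTyped S 0 (.close y) y T

/-- Configuration typing `Δ₀ ⊩ C :: Δ`. As usual for linear contexts, contexts are joined only
when no channel is duplicated; this includes the bound channels of the subconfigurations, which are
named apart. -/
inductive CTyped (S : Sig Lab TN ar) : Ctx Lab TN → Config Lab TN ar → Ctx Lab TN → Prop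
  | emp₁ {x : Chan} {A B : Ty Lab TN} (hAB : TyEq S A B) : CTyped S {(x, A)} 0 {(x, B)}
  | emp₂ : CTyped S 0 0 0
  | comp {Δ₀ Δ₀' Δ : Ctx Lab TN} {C C₁ : Config Lab TN ar} {x : Chan} {A : Ty Lab TN}
      (hC : CTyped S Δ₀ C Δ) (hC₁ : CTyped S Δ₀' C₁ {(x, A)})
      (hd : Disjoint (names Δ₀ C Δ) (names Δ₀' C₁ {(x, A)})) :
      CTyped S (Δ₀ + Δ₀') (C + C₁) ((x, A) ::ₘ Δ)
  | proc {Δ₀ Δ₀' Δ : Ctx Lab TN} {C : Config Lab TN ar} {x : Chan} {A : Ty Lab TN}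
      {P : Proc Lab TN ar Chan}
      (hC : CTyped S Δ₀ C Δ) (hP : PTyped S (Δ₀' + Δ) P x A)
      (hn : (((x, A) ::ₘ Δ₀').map Prod.fst).Nodup)
      (hd : Disjoint (Ctx.dom ((x, A) ::ₘ Δ₀')) (names Δ₀ C Δ)) :
      CTyped S (Δ₀ + Δ₀') (.proc x P ::ₘ C) {(x, A)}
  | msg {Δ₀ Δ₀' Δ : Ctx Lab TN} {C : Config Lab TN ar} {x : Chan} {A : Ty Lab TN}
      {M : Msg Lab}
      (hC : CTyped S Δ₀ C Δ) (hM : MTyped S (Δ₀' + Δ) M x A)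
      (hn : (((x, A) ::ₘ Δ₀').map Prod.fst).Nodup)
      (hd : Disjoint (Ctx.dom ((x, A) ::ₘ Δ₀')) (names Δ₀ C Δ)) :
      CTyped S (Δ₀ + Δ₀') (.msg M ::ₘ C) {(x, A)}

/-- The message `M` links its carrier `c` to the next generation of `c`. -/
def Msg.Links (M : Msg Lab) (c : Chan) : Prop := (∃ k, M = .lab c k) ∨ ∃ z, M = .send z c

/-- The naming convention for generations: two channels of `Δ ⊩ D :: K` share a base only if they
are generations of one session, i.e. the lower one is linked to its successor by a message of `D`
(and so on up to the higher one). -/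
def WellNamed (Δ : Ctx Lab TN) (K : Chan × Ty Lab TN) (D : Config Lab TN ar) : Prop :=
  ∀ c ∈ names Δ D {K}, ∀ c' ∈ names Δ D {K}, c.base = c'.base → c.gen < c'.gen →
    ∃ M : Msg Lab, Node.msg M ∈ D ∧ M.Links c

/-- `D ∈ Tree(Δ ⊩ K)`. -/
def Tree (S : Sig Lab TN ar) (Δ : Ctx Lab TN) (K : Chan × Ty Lab TN) (D : Config Lab TN ar) :
    Prop :=
  CTyped S Δ D {K} ∧ WellNamed Δ K D

/-! ## Asynchronous dynamics -/

/-- One rewriting step. `N` is the set of free channels of the interface, which a fresh channel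
has to avoid as well. -/
inductive Step (S : Sig Lab TN ar) (N : Set Chan) :
    Config Lab TN ar → Config Lab TN ar → Prop
  | spawn {C : Config Lab TN ar} {y : Chan} {X : PN} {γ : Fin (ar X) → Chan}
      {Q : Proc Lab TN ar (Option Chan)} {b : ℕ}
      (hb : ∀ c ∈ N ∪ Config.chans (.proc y (.spawn X γ Q) ::ₘ C), c.base ≠ b) :
      Step S N (.proc y (.spawn X γ Q) ::ₘ C)
        (.proc ⟨b, 0⟩ ((S.body X).map (fun o => o.elim ⟨b, 0⟩ γ)) ::ₘ
          .proc y (Q.map (inst ⟨b, 0⟩)) ::ₘ C)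
  | dfwd {C : Config Lab TN ar} {y x : Chan} {Y : TN} :
      Step S N (.proc y (.fwd Y y x) ::ₘ C) (.proc y (fwder ar (S.tyDef Y) y x) ::ₘ C)
  | oneSnd {C : Config Lab TN ar} {y : Chan} :
      Step S N (.proc y (.close y) ::ₘ C) (.msg (.close y) ::ₘ C)
  | oneRcv {C : Config Lab TN ar} {y x : Chan} {Q : Proc Lab TN ar Chan} (h : x ≠ y) :
      Step S N (.msg (.close y) ::ₘ .proc x (.wait y Q) ::ₘ C) (.proc x Q ::ₘ C)
  | plusSnd {C : Config Lab TN ar} {y : Chan} {k : Lab} {P : Proc Lab TN ar Chan} :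
      Step S N (.proc y (.sel y k P) ::ₘ C)
        (.proc y.next (P.map (advance y)) ::ₘ .msg (.lab y k) ::ₘ C)
  | plusRcv {C : Config Lab TN ar} {y u : Chan} {k : Lab} {L : Finset Lab}
      {P : Lab → Proc Lab TN ar Chan} (h : u ≠ y) (hk : k ∈ L) :
      Step S N (.msg (.lab y k) ::ₘ .proc u (.case y L P) ::ₘ C)
        (.proc u ((P k).map (advance y)) ::ₘ C)
  | ampSnd {C : Config Lab TN ar} {y x : Chan} {k : Lab} {P : Proc Lab TN ar Chan}
      (h : y ≠ x) :
      Step S N (.proc y (.sel x k P) ::ₘ C)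
        (.msg (.lab x k) ::ₘ .proc y (P.map (advance x)) ::ₘ C)
  | ampRcv {C : Config Lab TN ar} {y : Chan} {k : Lab} {L : Finset Lab}
      {P : Lab → Proc Lab TN ar Chan} (hk : k ∈ L) :
      Step S N (.proc y (.case y L P) ::ₘ .msg (.lab y k) ::ₘ C)
        (.proc y.next ((P k).map (advance y)) ::ₘ C)
  | tensorSnd {C : Config Lab TN ar} {y x : Chan} {P : Proc Lab TN ar Chan} :
      Step S N (.proc y (.send x y P) ::ₘ C)
        (.proc y.next (P.map (advance y)) ::ₘ .msg (.send x y) ::ₘ C)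
  | tensorRcv {C : Config Lab TN ar} {y x u : Chan} {P : Proc Lab TN ar (Option Chan)}
      (h : u ≠ y) :
      Step S N (.msg (.send x y) ::ₘ .proc u (.recv y P) ::ₘ C)
        (.proc u (P.map (fun o => inst x (o.map (advance y)))) ::ₘ C)
  | lolliSnd {C : Config Lab TN ar} {y x u : Chan} {P : Proc Lab TN ar Chan} (h : y ≠ u) :
      Step S N (.proc y (.send x u P) ::ₘ C)
        (.msg (.send x u) ::ₘ .proc y (P.map (advance u)) ::ₘ C)
  | lolliRcv {C : Config Lab TN ar} {y x : Chan} {P : Proc Lab TN ar (Option Chan)} :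
      Step S N (.proc y (.recv y P) ::ₘ .msg (.send x y) ::ₘ C)
        (.proc y.next (P.map (fun o => inst x (o.map (advance y)))) ::ₘ C)

/-- The channels of the interface `Δ ⊩ K`. -/
def iface (Δ : Ctx Lab TN) (K : Chan × Ty Lab TN) : Set Chan := Ctx.dom (K ::ₘ Δ)

/-- Renaming of bound channels: bases that occur in the interface are fixed, generations are
kept. -/
def AlphaEq (Δ : Ctx Lab TN) (K : Chan × Ty Lab TN) (D D' : Config Lab TN ar) : Prop :=
  ∃ ρ : Equiv.Perm ℕ, (∀ c ∈ iface Δ K, ρ c.base = c.base) ∧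
    D' = D.map (Node.map (fun c => ⟨ρ c.base, c.gen⟩))

/-- `D ↦* D'` (zero or more steps), configurations being taken up to renaming of bound
channels. -/
def Steps (S : Sig Lab TN ar) (Δ : Ctx Lab TN) (K : Chan × Ty Lab TN)
    (D D' : Config Lab TN ar) : Prop :=
  ∃ D'', Relation.ReflTransGen (Step S (iface Δ K)) D D'' ∧ AlphaEq Δ K D'' D'

/-- The set `Υ`: interface channels along which a message in `D` is ready to be sent. -/
def sendReady (Δ : Ctx Lab TN) (K : Chan × Ty Lab TN) (D : Config Lab TN ar) : Set Chan :=
  {y | y ∈ iface Δ K ∧ ∃ M : Msg Lab, Node.msg M ∈ D ∧ M.carrier = y}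

/-- The process term is blocked on receiving along `y`. -/
def Proc.Waits (P : Proc Lab TN ar Chan) (y : Chan) : Prop :=
  (∃ Q, P = .wait y Q) ∨ (∃ L Q, P = .case y L Q) ∨ ∃ Q, P = .recv y Q

/-- The set `Θ`: interface channels along which a process in `D` is waiting to receive. -/
def recvReady (Δ : Ctx Lab TN) (K : Chan × Ty Lab TN) (D : Config Lab TN ar) : Set Chan :=
  {y | y ∈ iface Δ K ∧ ∃ u P, Node.proc u P ∈ D ∧ P.Waits y}

/-- `Out(Δ ⊩ K)` and `In(Δ ⊩ K)`. -/
def Outs (S : Sig Lab TN ar) (Δ : Ctx Lab TN) (K : Chan × Ty Lab TN) : Set Chan :=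
  {y | (y = K.1 ∧ S.Pos K.2) ∨ ∃ T, (y, T) ∈ Δ ∧ S.Neg T}

def Ins (S : Sig Lab TN ar) (Δ : Ctx Lab TN) (K : Chan × Ty Lab TN) : Set Chan :=
  {y | (y = K.1 ∧ S.Neg K.2) ∨ ∃ T, (y, T) ∈ Δ ∧ S.Pos T}

/-! ## The logical relation -/

/-- `x` has a base that is fresh for the interface and for both configurations. -/
def FreshFor (x : Chan) (Δ : Ctx Lab TN) (K : Chan × Ty Lab TN) (D₁ D₂ : Config Lab TN ar) :
    Prop :=
  ∀ c ∈ iface Δ K ∪ Config.chans D₁ ∪ Config.chans D₂, c.base ≠ x.base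

/-- The value interpretation `V⟦Δ ⊩ K⟧_{·;y}^{m+1}` (clauses asserting that a message is sent
along `y`), where `E` is the term interpretation at index `m`. -/
inductive VSend (S : Sig Lab TN ar)
    (E : Ctx Lab TN → Chan × Ty Lab TN → Config Lab TN ar → Config Lab TN ar → Prop) :
    Ctx Lab TN → Chan × Ty Lab TN → Chan → Config Lab TN ar → Config Lab TN ar → Prop
  | oneR {y : Chan} {T : Ty Lab TN} (hT : S.unfold T = .one)
      (ht : Tree S 0 (y, T) {Node.msg (.close y)}) :
      VSend S E 0 (y, T) y {Node.msg (.close y)} {Node.msg (.close y)}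
  | plusR {Δ : Ctx Lab TN} {y : Chan} {T : Ty Lab TN} {L : Finset Lab} {A : Lab → Ty Lab TN}
      {k : Lab} {D₁ D₂ : Config Lab TN ar} (hT : S.unfold T = .plus L A) (hk : k ∈ L)
      (h₁ : Tree S Δ (y, T) (.msg (.lab y k) ::ₘ D₁))
      (h₂ : Tree S Δ (y, T) (.msg (.lab y k) ::ₘ D₂))
      (hE : E Δ (y.next, A k) D₁ D₂) :
      VSend S E Δ (y, T) y (.msg (.lab y k) ::ₘ D₁) (.msg (.lab y k) ::ₘ D₂)
  | tensorR {Δ' Δ'' : Ctx Lab TN} {y x : Chan} {T A B : Ty Lab TN}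
      {D₁ D₂ T₁ T₂ : Config Lab TN ar} (hT : S.unfold T = .tensor A B)
      (h₁ : Tree S (Δ' + Δ'') (y, T) (.msg (.send x y) ::ₘ (D₁ + T₁)))
      (h₂ : Tree S (Δ' + Δ'') (y, T) (.msg (.send x y) ::ₘ (D₂ + T₂)))
      (ht₁ : Tree S Δ'' (x, A) T₁) (ht₂ : Tree S Δ'' (x, A) T₂)
      (hET : E Δ'' (x, A) T₁ T₂) (hE : E Δ' (y.next, B) D₁ D₂) :
      VSend S E (Δ' + Δ'') (y, T) y
        (.msg (.send x y) ::ₘ (D₁ + T₁)) (.msg (.send x y) ::ₘ (D₂ + T₂))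
  | ampL {Δ : Ctx Lab TN} {K : Chan × Ty Lab TN} {y : Chan} {T : Ty Lab TN} {L : Finset Lab}
      {A : Lab → Ty Lab TN} {k : Lab} {D₁ D₂ : Config Lab TN ar}
      (hT : S.unfold T = .amp L A) (hk : k ∈ L)
      (h₁ : Tree S ((y, T) ::ₘ Δ) K (.msg (.lab y k) ::ₘ D₁))
      (h₂ : Tree S ((y, T) ::ₘ Δ) K (.msg (.lab y k) ::ₘ D₂))
      (hE : E ((y.next, A k) ::ₘ Δ) K D₁ D₂) :
      VSend S E ((y, T) ::ₘ Δ) K y (.msg (.lab y k) ::ₘ D₁) (.msg (.lab y k) ::ₘ D₂)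
  | lolliL {Δ' Δ'' : Ctx Lab TN} {K : Chan × Ty Lab TN} {y x : Chan} {T A B : Ty Lab TN}
      {D₁ D₂ T₁ T₂ : Config Lab TN ar} (hT : S.unfold T = .lolli A B)
      (h₁ : Tree S ((y, T) ::ₘ (Δ' + Δ'')) K (.msg (.send x y) ::ₘ (T₁ + D₁)))
      (h₂ : Tree S ((y, T) ::ₘ (Δ' + Δ'')) K (.msg (.send x y) ::ₘ (T₂ + D₂)))
      (ht₁ : Tree S Δ' (x, A) T₁) (ht₂ : Tree S Δ' (x, A) T₂)
      (hET : E Δ' (x, A) T₁ T₂) (hE : E ((y.next, B) ::ₘ Δ'') K D₁ D₂) :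
      VSend S E ((y, T) ::ₘ (Δ' + Δ'')) K y
        (.msg (.send x y) ::ₘ (T₁ + D₁)) (.msg (.send x y) ::ₘ (T₂ + D₂))

/-- The value interpretation `V⟦Δ ⊩ K⟧_{y;·}^{m+1}` (clauses assuming that a message is received
along `y`), where `E` is the term interpretation at index `m`. -/
inductive VRecv (S : Sig Lab TN ar)
    (E : Ctx Lab TN → Chan × Ty Lab TN → Config Lab TN ar → Config Lab TN ar → Prop) :
    Ctx Lab TN → Chan × Ty Lab TN → Chan → Config Lab TN ar → Config Lab TN ar → Prop
  | ampR {Δ : Ctx Lab TN} {y : Chan} {T : Ty Lab TN} {L : Finset Lab} {A : Lab → Ty Lab TN}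
      {D₁ D₂ : Config Lab TN ar} (hT : S.unfold T = .amp L A)
      (h₁ : Tree S Δ (y, T) D₁) (h₂ : Tree S Δ (y, T) D₂)
      (hE : ∀ k ∈ L, E Δ (y.next, A k) (.msg (.lab y k) ::ₘ D₁) (.msg (.lab y k) ::ₘ D₂)) :
      VRecv S E Δ (y, T) y D₁ D₂
  | lolliR {Δ : Ctx Lab TN} {y : Chan} {T A B : Ty Lab TN} {D₁ D₂ : Config Lab TN ar}
      (hT : S.unfold T = .lolli A B)
      (h₁ : Tree S Δ (y, T) D₁) (h₂ : Tree S Δ (y, T) D₂)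
      (hE : ∀ x, FreshFor x Δ (y, T) D₁ D₂ →
        E ((x, A) ::ₘ Δ) (y.next, B) (.msg (.send x y) ::ₘ D₁) (.msg (.send x y) ::ₘ D₂)) :
      VRecv S E Δ (y, T) y D₁ D₂
  | oneL {Δ : Ctx Lab TN} {K : Chan × Ty Lab TN} {y : Chan} {T : Ty Lab TN}
      {D₁ D₂ : Config Lab TN ar} (hT : S.unfold T = .one)
      (h₁ : Tree S ((y, T) ::ₘ Δ) K D₁) (h₂ : Tree S ((y, T) ::ₘ Δ) K D₂)
      (hE : E Δ K (.msg (.close y) ::ₘ D₁) (.msg (.close y) ::ₘ D₂)) :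
      VRecv S E ((y, T) ::ₘ Δ) K y D₁ D₂
  | plusL {Δ : Ctx Lab TN} {K : Chan × Ty Lab TN} {y : Chan} {T : Ty Lab TN} {L : Finset Lab}
      {A : Lab → Ty Lab TN} {D₁ D₂ : Config Lab TN ar} (hT : S.unfold T = .plus L A)
      (h₁ : Tree S ((y, T) ::ₘ Δ) K D₁) (h₂ : Tree S ((y, T) ::ₘ Δ) K D₂)
      (hE : ∀ k ∈ L, E ((y.next, A k) ::ₘ Δ) K
        (.msg (.lab y k) ::ₘ D₁) (.msg (.lab y k) ::ₘ D₂)) :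
      VRecv S E ((y, T) ::ₘ Δ) K y D₁ D₂
  | tensorL {Δ : Ctx Lab TN} {K : Chan × Ty Lab TN} {y : Chan} {T A B : Ty Lab TN}
      {D₁ D₂ : Config Lab TN ar} (hT : S.unfold T = .tensor A B)
      (h₁ : Tree S ((y, T) ::ₘ Δ) K D₁) (h₂ : Tree S ((y, T) ::ₘ Δ) K D₂)
      (hE : ∀ x, FreshFor x ((y, T) ::ₘ Δ) K D₁ D₂ →
        E ((x, A) ::ₘ (y.next, B) ::ₘ Δ) K (.msg (.send x y) ::ₘ D₁) (.msg (.send x y) ::ₘ D₂)) :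
      VRecv S E ((y, T) ::ₘ Δ) K y D₁ D₂

/-- The term interpretation `E⟦Δ ⊩ K⟧^m`. -/
def ERel (S : Sig Lab TN ar) : ℕ → Ctx Lab TN → Chan × Ty Lab TN →
    Config Lab TN ar → Config Lab TN ar → Prop
  | 0, Δ, K, D₁, D₂ => Tree S Δ K D₁ ∧ Tree S Δ K D₂
  | m + 1, Δ, K, D₁, D₂ =>
    (Tree S Δ K D₁ ∧ Tree S Δ K D₂) ∧
    ∀ D₁', Steps S Δ K D₁ D₁' →
      ∃ D₂', Steps S Δ K D₂ D₂' ∧ sendReady Δ K D₁' ⊆ sendReady Δ K D₂' ∧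
        (∀ y ∈ Outs S Δ K, y ∈ sendReady Δ K D₁' → VSend S (ERel S m) Δ K y D₁' D₂') ∧
        ∀ y ∈ Ins S Δ K, y ∈ recvReady Δ K D₁' → VRecv S (ERel S m) Δ K y D₁' D₂'

/-- Logical equivalence `(Δ ⊩ D₁ :: K) ≡ (Δ ⊩ D₂ :: K)`. -/
def LogEquiv (S : Sig Lab TN ar) (Δ : Ctx Lab TN) (K : Chan × Ty Lab TN)
    (D₁ D₂ : Config Lab TN ar) : Prop :=
  (Tree S Δ K D₁ ∧ Tree S Δ K D₂) ∧
    (∀ m, ERel S m Δ K D₁ D₂) ∧ ∀ m, ERel S m Δ K D₂ D₁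

end

end RSLR

/-!
# Reflexivity of logical equivalence for session-typed configurations

A tree `D ∈ Tree(Δ ⊩ K)` is related to itself at every index `m`, by induction on `m`. If
`D ↦* D'`, the second copy of `D` makes the same steps, so it remains to see that `D'` satisfies
the clauses of the value relations on the diagonal, for which the components of the clauses only
have to be trees again. Three facts about trees are needed:

* reduction and renaming of bound channels preserve trees (`Step.preserve`, `Tree.steps`);
* a message of `D'` sent along an interface channel can be taken off, leaving one tree, or two
  trees for a channel message (`Tree.vSend`);
* a message can be added at an interface channel on which a process of `D'` waits (`Tree.vRecv`).

All of them cut a configuration open at some node and put it together differently. A derivation of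
`CTyped` can only be taken apart from its root, so it is first turned into a derivation of
`SeqTyped`, which adds one node at a time on top of the forest built so far
(`CTyped.seqTyped`, `SeqTyped.cTyped`). In this presentation configurations are composed like
arrows of a monoidal category (`SeqTyped.comp`, `SeqTyped.frame`), can be cut at every node
(`SeqTyped.cut`), and release the channels that they do not touch (`SeqTyped.unframe`). Two nodes
that share a channel can be moved next to each other (`SeqTyped.linked`); a reduction step then
replaces one node by one or two others, or two adjacent nodes by one.

The naming convention enters when a message is sent along, or added at, a channel `y`: the next
generation of `y` must be unused. It is, provided no message links `y` to it yet, and linearity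
excludes such a message: the provider and the user of `y` would disagree on the polarity of its
type (`SeqTyped.not_linked_of_sends`), or `y` would occur in two nodes and hence not be an
interface channel (`SeqTyped.not_linked_of_waits`). Conversely, a channel on which a message has
been received no longer occurs, so the removed link is not missed.
-/

namespace RSLR

section

variable {Lab TN PN : Type} {ar : PN → ℕ} {S : Sig Lab TN ar}

/-! ### Equi-recursive type equality -/

theorem HeadRel.mono {R R' : Ty Lab TN → Ty Lab TN → Prop} (h : ∀ A B, R A B → R' A B)
    {A B : Ty Lab TN} (hAB : HeadRel R A B) : HeadRel R' A B := by
  cases hAB with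
  | one => exact .one
  | plus h' => exact .plus fun l hl => h _ _ (h' l hl)
  | amp h' => exact .amp fun l hl => h _ _ (h' l hl)
  | tensor h₁ h₂ => exact .tensor (h _ _ h₁) (h _ _ h₂)
  | lolli h₁ h₂ => exact .lolli (h _ _ h₁) (h _ _ h₂)

theorem HeadRel.flip {R : Ty Lab TN → Ty Lab TN → Prop} {A B : Ty Lab TN} (h : HeadRel R A B) :
    HeadRel (fun A B => R B A) B A := by
  cases h with
  | one => exact .one
  | plus h => exact .plus h
  | amp h => exact .amp h
  | tensor h₁ h₂ => exact .tensor h₁ h₂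
  | lolli h₁ h₂ => exact .lolli h₁ h₂

theorem TyEq.head {A B : Ty Lab TN} (h : TyEq S A B) :
    HeadRel (TyEq S) (S.unfold A) (S.unfold B) := by
  obtain ⟨R, hR, hAB⟩ := h
  exact (hR _ _ hAB).mono fun _ _ h' => ⟨R, hR, h'⟩

theorem TyEq.of_head {A B : Ty Lab TN} (h : HeadRel (TyEq S) (S.unfold A) (S.unfold B)) :
    TyEq S A B :=
  ⟨fun A B => HeadRel (TyEq S) (S.unfold A) (S.unfold B),
    fun _ _ h' => h'.mono fun _ _ h'' => h''.head, h⟩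

theorem TyEq.symm {A B : Ty Lab TN} (h : TyEq S A B) : TyEq S B A :=
  ⟨fun A B => TyEq S B A, fun _ _ h' => h'.head.flip, h⟩

theorem TyEq.trans {A B C : Ty Lab TN} (h : TyEq S A B) (h' : TyEq S B C) : TyEq S A C := by
  refine ⟨fun A C => ∃ B, TyEq S A B ∧ TyEq S B C, ?_, B, h, h'⟩
  rintro A C ⟨B, h₁, h₂⟩
  have h₁ := h₁.head
  have h₂ := h₂.head
  revert h₁ h₂
  generalize S.unfold A = A'
  generalize S.unfold B = B'
  generalize S.unfold C = C'
  intro h₁ h₂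
  cases h₁ <;> cases h₂
  · exact .one
  · exact .plus fun l hl => ⟨_, by solve_by_elim, by solve_by_elim⟩
  · exact .amp fun l hl => ⟨_, by solve_by_elim, by solve_by_elim⟩
  · exact .tensor ⟨_, by assumption, by assumption⟩ ⟨_, by assumption, by assumption⟩
  · exact .lolli ⟨_, by assumption, by assumption⟩ ⟨_, by assumption, by assumption⟩

/-- Reflexivity needs contractiveness: a variable defined as a variable has no unfolding, hence is
not even related to itself. -/
theorem TyEq.refl (hS : S.WF) (A : Ty Lab TN) : TyEq S A A := by
  refine ⟨Eq, ?_, rfl⟩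
  rintro A _ rfl
  have hA : ∀ Z, S.unfold A ≠ .var Z := by
    intro Z
    cases A with
    | var Y => exact hS.contr Y Z
    | _ => simp [Sig.unfold]
  cases h : S.unfold A with
  | one => exact .one
  | plus => exact .plus fun _ _ => rfl
  | amp => exact .amp fun _ _ => rfl
  | tensor => exact .tensor rfl rfl
  | lolli => exact .lolli rfl rfl
  | var Z => exact absurd h (hA Z)

theorem Sig.WF.unfold_unfold (hS : S.WF) (A : Ty Lab TN) :
    S.unfold (S.unfold A) = S.unfold A := by
  cases A with
  | var Y =>
    change S.unfold (S.tyDef Y) = S.tyDef Y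
    cases h : S.tyDef Y with
    | var Z => exact absurd h (hS.contr Y Z)
    | _ => rfl
  | _ => rfl

theorem TyEq.unfold (hS : S.WF) (A : Ty Lab TN) : TyEq S A (S.unfold A) := by
  refine .of_head ?_
  rw [hS.unfold_unfold]
  exact (TyEq.refl hS A).head

theorem TyEq.of_unfold_eq (hS : S.WF) {A B : Ty Lab TN} (h : S.unfold A = B) : TyEq S A B :=
  h ▸ TyEq.unfold hS A

theorem TyEq.plus_inj {T : Ty Lab TN} {L L' : Finset Lab} {A A' : Lab → Ty Lab TN}
    (h : TyEq S T (.plus L A)) (h' : TyEq S T (.plus L' A')) :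
    L = L' ∧ ∀ l ∈ L, TyEq S (A l) (A' l) := by
  cases (h.symm.trans h').head with
  | plus h => exact ⟨rfl, h⟩

theorem TyEq.amp_inj {T : Ty Lab TN} {L L' : Finset Lab} {A A' : Lab → Ty Lab TN}
    (h : TyEq S T (.amp L A)) (h' : TyEq S T (.amp L' A')) :
    L = L' ∧ ∀ l ∈ L, TyEq S (A l) (A' l) := by
  cases (h.symm.trans h').head with
  | amp h => exact ⟨rfl, h⟩

theorem TyEq.tensor_inj {T A B A' B' : Ty Lab TN}
    (h : TyEq S T (.tensor A B)) (h' : TyEq S T (.tensor A' B')) :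
    TyEq S A A' ∧ TyEq S B B' := by
  cases (h.symm.trans h').head with
  | tensor h₁ h₂ => exact ⟨h₁, h₂⟩

theorem TyEq.lolli_inj {T A B A' B' : Ty Lab TN}
    (h : TyEq S T (.lolli A B)) (h' : TyEq S T (.lolli A' B')) :
    TyEq S A A' ∧ TyEq S B B' := by
  cases (h.symm.trans h').head with
  | lolli h₁ h₂ => exact ⟨h₁, h₂⟩

theorem TyEq.exists_plus {T : Ty Lab TN} {L : Finset Lab} {B : Lab → Ty Lab TN}
    (h : TyEq S T (.plus L B)) :
    ∃ A, S.unfold T = .plus L A ∧ ∀ l ∈ L, TyEq S (A l) (B l) := by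
  have h := h.head
  generalize S.unfold T = U at h
  cases h with
  | plus h => exact ⟨_, rfl, h⟩

theorem TyEq.exists_amp {T : Ty Lab TN} {L : Finset Lab} {B : Lab → Ty Lab TN}
    (h : TyEq S T (.amp L B)) :
    ∃ A, S.unfold T = .amp L A ∧ ∀ l ∈ L, TyEq S (A l) (B l) := by
  have h := h.head
  generalize S.unfold T = U at h
  cases h with
  | amp h => exact ⟨_, rfl, h⟩

theorem TyEq.exists_tensor {T B C : Ty Lab TN} (h : TyEq S T (.tensor B C)) :
    ∃ A A', S.unfold T = .tensor A A' ∧ TyEq S A B ∧ TyEq S A' C := by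
  have h := h.head
  generalize S.unfold T = U at h
  cases h with
  | tensor h₁ h₂ => exact ⟨_, _, rfl, h₁, h₂⟩

theorem TyEq.exists_lolli {T B C : Ty Lab TN} (h : TyEq S T (.lolli B C)) :
    ∃ A A', S.unfold T = .lolli A A' ∧ TyEq S A B ∧ TyEq S A' C := by
  have h := h.head
  generalize S.unfold T = U at h
  cases h with
  | lolli h₁ h₂ => exact ⟨_, _, rfl, h₁, h₂⟩

theorem TyEq.unfold_one {T : Ty Lab TN} (h : TyEq S T .one) : S.unfold T = .one := by
  have h := h.head
  generalize S.unfold T = U at h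
  cases h
  rfl

theorem TyEq.pos {A B : Ty Lab TN} (h : TyEq S A B) (hB : S.Pos B) : S.Pos A := by
  have h := h.head
  rcases hB with hB | ⟨L, C, hB⟩ | ⟨C, D, hB⟩ <;> rw [hB] at h
  · generalize hA : S.unfold A = A' at h
    cases h
    exact .inl hA
  · generalize hA : S.unfold A = A' at h
    cases h
    exact .inr (.inl ⟨_, _, hA⟩)
  · generalize hA : S.unfold A = A' at h
    cases h
    exact .inr (.inr ⟨_, _, hA⟩)

theorem Sig.Pos.not_neg {A : Ty Lab TN} (h : S.Pos A) : ¬ S.Neg A := by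
  rintro (⟨L, B, h'⟩ | ⟨B, C, h'⟩) <;> rcases h with h | ⟨L, B, h⟩ | ⟨B, C, h⟩ <;>
    rw [h'] at h <;> cases h

theorem TyEq.neg {A B : Ty Lab TN} (h : TyEq S A B) (hB : S.Neg B) : S.Neg A := by
  have h := h.head
  rcases hB with ⟨L, C, hB⟩ | ⟨C, D, hB⟩ <;> rw [hB] at h
  · generalize hA : S.unfold A = A' at h
    cases h
    exact .inl ⟨_, _, hA⟩
  · generalize hA : S.unfold A = A' at h
    cases h
    exact .inr ⟨_, _, hA⟩

/-! ### Contexts -/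

/-- Contexts that agree up to equi-recursive equality of the types. -/
def CtxEq (S : Sig Lab TN ar) {V : Type} (Ω Ω' : Multiset (V × Ty Lab TN)) : Prop :=
  Multiset.Rel (fun p q => p.1 = q.1 ∧ TyEq S p.2 q.2) Ω Ω'

theorem CtxEq.refl (hS : S.WF) {V : Type} (Ω : Multiset (V × Ty Lab TN)) : CtxEq S Ω Ω :=
  Multiset.rel_refl_of_refl_on fun p _ => ⟨rfl, TyEq.refl hS p.2⟩

theorem CtxEq.trans {V : Type} {Ω Ω' Ω'' : Multiset (V × Ty Lab TN)} (h : CtxEq S Ω Ω')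
    (h' : CtxEq S Ω' Ω'') : CtxEq S Ω Ω'' :=
  haveI : IsTrans (V × Ty Lab TN) (fun p q => p.1 = q.1 ∧ TyEq S p.2 q.2) :=
    ⟨fun _ _ _ h h' => ⟨h.1.trans h'.1, h.2.trans h'.2⟩⟩
  Multiset.Rel.trans _ h h'

theorem CtxEq.cons {V : Type} {Ω Ω' : Multiset (V × Ty Lab TN)} {x : V} {A B : Ty Lab TN}
    (hAB : TyEq S A B) (h : CtxEq S Ω Ω') : CtxEq S ((x, A) ::ₘ Ω) ((x, B) ::ₘ Ω') :=
  Multiset.Rel.cons ⟨rfl, hAB⟩ h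

theorem CtxEq.map_fst {V : Type} {Ω Ω' : Multiset (V × Ty Lab TN)} (h : CtxEq S Ω Ω') :
    Ω.map Prod.fst = Ω'.map Prod.fst := by
  induction h with
  | zero => rfl
  | cons h _ ih => simp [h.1, ih]

theorem CtxEq.cons_right {V : Type} {Ω Ω' : Multiset (V × Ty Lab TN)} {x : V} {B : Ty Lab TN}
    (h : CtxEq S Ω ((x, B) ::ₘ Ω')) :
    ∃ A Ω₁, Ω = (x, A) ::ₘ Ω₁ ∧ TyEq S A B ∧ CtxEq S Ω₁ Ω' := by
  obtain ⟨⟨x', A⟩, Ω₁, ⟨h₁, h₂⟩, h₃, h₄⟩ := Multiset.rel_cons_right.1 h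
  obtain rfl : x' = x := h₁
  exact ⟨A, Ω₁, h₄, h₂, h₃⟩

theorem CtxEq.zero_right {V : Type} {Ω : Multiset (V × Ty Lab TN)} (h : CtxEq S Ω 0) : Ω = 0 :=
  Multiset.rel_zero_right.1 h

theorem Ctx.mem_dom {Δ : Ctx Lab TN} {c : Chan} : c ∈ Ctx.dom Δ ↔ c ∈ Δ.map Prod.fst := by
  simp [Ctx.dom]

theorem Ctx.dom_zero : Ctx.dom (0 : Ctx Lab TN) = ∅ := by
  ext c; simp [Ctx.mem_dom]

theorem Ctx.dom_cons (p : Chan × Ty Lab TN) (Δ : Ctx Lab TN) :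
    Ctx.dom (p ::ₘ Δ) = insert p.1 (Ctx.dom Δ) := by
  ext c; simp [Ctx.mem_dom]

theorem Ctx.dom_singleton (p : Chan × Ty Lab TN) : Ctx.dom {p} = {p.1} := by
  ext c; simp [Ctx.mem_dom]

theorem Ctx.dom_add (Δ Δ' : Ctx Lab TN) : Ctx.dom (Δ + Δ') = Ctx.dom Δ ∪ Ctx.dom Δ' := by
  ext c; simp only [Ctx.mem_dom, Multiset.map_add, Multiset.mem_add, Set.mem_union]

theorem Ctx.mem_dom_cons {p : Chan × Ty Lab TN} {Δ : Ctx Lab TN} {c : Chan} :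
    c ∈ Ctx.dom (p ::ₘ Δ) ↔ c = p.1 ∨ c ∈ Ctx.dom Δ := by
  rw [Ctx.dom_cons]; rfl

theorem Ctx.mem_dom_singleton {p : Chan × Ty Lab TN} {c : Chan} :
    c ∈ Ctx.dom {p} ↔ c = p.1 := by
  rw [Ctx.dom_singleton]; rfl

theorem Ctx.mem_dom_add {Δ Δ' : Ctx Lab TN} {c : Chan} :
    c ∈ Ctx.dom (Δ + Δ') ↔ c ∈ Ctx.dom Δ ∨ c ∈ Ctx.dom Δ' := by
  rw [Ctx.dom_add]; rfl

theorem Ctx.not_mem_dom_zero {c : Chan} : c ∉ Ctx.dom (0 : Ctx Lab TN) := by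
  rw [Ctx.dom_zero]; exact id

theorem CtxEq.dom {Δ Δ' : Ctx Lab TN} (h : CtxEq S Δ Δ') : Ctx.dom Δ = Ctx.dom Δ' := by
  ext c; rw [Ctx.mem_dom, Ctx.mem_dom, h.map_fst]

/-- No channel is assigned a type twice. -/
def Ctx.Linear (Δ : Ctx Lab TN) : Prop := (Δ.map Prod.fst).Nodup

theorem Ctx.linear_zero : Ctx.Linear (0 : Ctx Lab TN) := by simp [Ctx.Linear]

theorem Ctx.linear_cons {p : Chan × Ty Lab TN} {Δ : Ctx Lab TN} :
    Ctx.Linear (p ::ₘ Δ) ↔ p.1 ∉ Ctx.dom Δ ∧ Ctx.Linear Δ := by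
  rw [Ctx.Linear, Multiset.map_cons, Multiset.nodup_cons, Ctx.mem_dom, Ctx.Linear]

theorem Ctx.linear_singleton (p : Chan × Ty Lab TN) : Ctx.Linear {p} := by simp [Ctx.Linear]

theorem Ctx.linear_add {Δ Δ' : Ctx Lab TN} :
    Ctx.Linear (Δ + Δ') ↔
      Ctx.Linear Δ ∧ Ctx.Linear Δ' ∧ ∀ c ∈ Ctx.dom Δ, c ∉ Ctx.dom Δ' := by
  simp only [Ctx.Linear, Multiset.map_add, Multiset.nodup_add, Multiset.disjoint_left,
    Ctx.mem_dom]

theorem CtxEq.linear {Δ Δ' : Ctx Lab TN} (h : CtxEq S Δ Δ') (hΔ : Ctx.Linear Δ) :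
    Ctx.Linear Δ' := by
  rwa [Ctx.Linear, ← h.map_fst]

theorem Ctx.exists_cons_of_mem_dom {Δ : Ctx Lab TN} {y : Chan} (h : y ∈ Ctx.dom Δ) :
    ∃ T Δ', Δ = (y, T) ::ₘ Δ' := by
  obtain ⟨T, hT⟩ := h
  obtain ⟨Δ', rfl⟩ := Multiset.exists_cons_of_mem hT
  exact ⟨T, Δ', rfl⟩

theorem Ctx.Linear.cons_inj {Δ Δ' : Ctx Lab TN} {y : Chan} {T T' : Ty Lab TN}
    (hΔ : Ctx.Linear ((y, T) ::ₘ Δ)) (h : (y, T) ::ₘ Δ = (y, T') ::ₘ Δ') : T = T' ∧ Δ = Δ' := by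
  rcases Multiset.cons_eq_cons.1 h with ⟨h₁, h₂⟩ | ⟨_, Θ, h₁, h₂⟩
  · exact ⟨(Prod.ext_iff.1 h₁).2, h₂⟩
  · rw [h₁] at hΔ
    exact absurd (by rw [Ctx.dom_cons]; exact .inl rfl) (Ctx.linear_cons.1 hΔ).1

theorem CtxEq.symm {V : Type} {Ω Ω' : Multiset (V × Ty Lab TN)} (h : CtxEq S Ω Ω') :
    CtxEq S Ω' Ω := by
  induction h with
  | zero => exact .zero
  | cons h _ ih => exact Multiset.Rel.cons (And.intro h.1.symm h.2.symm) ih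

theorem CtxEq.cons_cancel {Ω Ω' : Ctx Lab TN} {y : Chan} {A B : Ty Lab TN}
    (h : CtxEq S ((y, A) ::ₘ Ω) ((y, B) ::ₘ Ω')) (hy : y ∉ Ctx.dom Ω) :
    TyEq S A B ∧ CtxEq S Ω Ω' := by
  obtain ⟨A', Ω₁, h₁, h₂, h₃⟩ := h.cons_right
  rcases Multiset.cons_eq_cons.1 h₁ with ⟨h₄, rfl⟩ | ⟨-, Θ, rfl, -⟩
  · cases h₄
    exact ⟨h₂, h₃⟩
  · simp [Ctx.mem_dom_cons] at hy

/-! ### Typing of process terms -/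

theorem lift_map {V W : Type} (f : V → W) (Ω : Multiset (V × Ty Lab TN)) :
    (lift Ω).map (Prod.map (Option.map f) id) = lift (Ω.map (Prod.map f id)) := by
  simp [lift, Prod.map]

theorem PTyped.map {V W : Type} {Ω : Multiset (V × Ty Lab TN)} {P : Proc Lab TN ar V} {x : V}
    {A : Ty Lab TN} (h : PTyped S Ω P x A) (f : V → W) :
    PTyped S (Ω.map (Prod.map f id)) (P.map f) (f x) A := by
  induction h generalizing W with
  | plusR hk _ ih => exact .plusR hk (ih f)
  | plusL _ ih =>
    simp only [Multiset.map_cons, Prod.map, Proc.map, id] at ih ⊢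
    exact .plusL fun k hk => ih k hk f
  | ampR _ ih => exact .ampR fun k hk => ih k hk f
  | ampL hk _ ih =>
    have ih := ih f
    simp only [Multiset.map_cons, Prod.map, id] at ih ⊢
    exact .ampL hk ih
  | tensorR _ ih =>
    simp only [Multiset.map_cons, Prod.map, id]
    exact .tensorR (ih f)
  | tensorL _ ih =>
    have ih := ih (Option.map f)
    rw [Multiset.map_cons, Multiset.map_cons, lift_map] at ih
    rw [Multiset.map_cons]
    exact .tensorL ih
  | lolliR _ ih =>
    have ih := ih (Option.map f)
    rw [Multiset.map_cons, lift_map] at ih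
    exact .lolliR ih
  | lolliL _ ih =>
    have ih := ih f
    rw [Multiset.map_cons] at ih
    rw [Multiset.map_cons, Multiset.map_cons]
    exact .lolliL ih
  | oneR => exact .oneR
  | oneL _ ih =>
    rw [Multiset.map_cons]
    exact .oneL (ih f)
  | tvarR hAB _ ih => exact .tvarR hAB (ih f)
  | tvarL hAB _ ih =>
    have ih := ih f
    rw [Multiset.map_cons] at ih ⊢
    exact .tvarL hAB ih
  | spawn _ ih =>
    have ih := ih (Option.map f)
    rw [Multiset.map_cons, lift_map] at ih
    rw [Multiset.map_add, Multiset.map_map]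
    exact .spawn ih
  | dfwd => exact .dfwd

theorem Proc.fn_map {V W : Type} (P : Proc Lab TN ar V) (f : V → W) :
    (P.map f).fn = f '' P.fn := by
  induction P generalizing W with
  | close x => simp [Proc.map, Proc.fn]
  | wait x Q ih => simp [Proc.map, Proc.fn, ih, Set.image_insert_eq]
  | sel x k P ih => simp [Proc.map, Proc.fn, ih, Set.image_insert_eq]
  | case x L Q ih =>
    ext w
    simp only [Proc.map, Proc.fn, ih, Set.singleton_union, Set.mem_insert_iff, Set.mem_ofPred_eq,
      Set.mem_image]
    constructor
    · rintro (rfl | ⟨l, hl, v, hv, rfl⟩)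
      · exact ⟨x, .inl rfl, rfl⟩
      · exact ⟨v, .inr ⟨l, hl, hv⟩, rfl⟩
    · rintro ⟨v, rfl | ⟨l, hl, hv⟩, rfl⟩
      · exact .inl rfl
      · exact .inr ⟨l, hl, v, hv, rfl⟩
  | send z x P ih => simp [Proc.map, Proc.fn, ih, Set.image_union, Set.image_insert_eq]
  | recv x P ih =>
    ext w
    simp only [Proc.map, Proc.fn, ih, Set.singleton_union, Set.mem_insert_iff, Set.mem_ofPred_eq,
      Set.mem_image]
    constructor
    · rintro (rfl | ⟨_ | v, hv, h⟩)
      · exact ⟨x, .inl rfl, rfl⟩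
      · cases h
      · exact ⟨v, .inr hv, Option.some.inj h⟩
    · rintro ⟨v, rfl | hv, rfl⟩
      · exact .inl rfl
      · exact .inr ⟨some v, hv, rfl⟩
  | spawn X γ Q ih =>
    ext w
    simp only [Proc.map, Proc.fn, ih, Set.mem_union, Set.mem_range, Set.mem_ofPred_eq,
      Set.mem_image]
    constructor
    · rintro (⟨i, rfl⟩ | ⟨_ | v, hv, h⟩)
      · exact ⟨γ i, .inl ⟨i, rfl⟩, rfl⟩
      · cases h
      · exact ⟨v, .inr hv, Option.some.inj h⟩
    · rintro ⟨v, ⟨i, rfl⟩ | hv, rfl⟩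
      · exact .inl ⟨i, rfl⟩
      · exact .inr ⟨some v, hv, rfl⟩
  | fwd Y y z => simp [Proc.map, Proc.fn, Set.image_insert_eq]

theorem some_mem_lift {V : Type} {Ω : Multiset (V × Ty Lab TN)} {v : V} {T : Ty Lab TN} :
    (some v, T) ∈ lift Ω ↔ (v, T) ∈ Ω := by
  simp [lift]

/-- The free names of a well-typed term are declared by its typing. The converse fails: a `case`
over the empty label set may leave channels unmentioned. -/
theorem PTyped.fn_subset {V : Type} {Ω : Multiset (V × Ty Lab TN)} {P : Proc Lab TN ar V} {x : V}
    {A : Ty Lab TN} (h : PTyped S Ω P x A) : ∀ v ∈ P.fn, v = x ∨ ∃ T, (v, T) ∈ Ω := by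
  induction h with
  | plusR hk _ ih => rintro v (rfl | hv); exacts [.inl rfl, ih v hv]
  | plusL _ ih =>
    rintro v (rfl | ⟨l, hl, hv⟩)
    · exact .inr ⟨_, Multiset.mem_cons_self _ _⟩
    · have := ih l hl v hv
      simp only [Multiset.mem_cons, Prod.mk.injEq] at this ⊢
      grind
  | ampR _ ih =>
    rintro v (rfl | ⟨l, hl, hv⟩)
    · exact .inl rfl
    · exact ih l hl v hv
  | ampL hk _ ih =>
    rintro v (rfl | hv)
    · exact .inr ⟨_, Multiset.mem_cons_self _ _⟩
    · have := ih v hv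
      simp only [Multiset.mem_cons, Prod.mk.injEq] at this ⊢
      grind
  | tensorR _ ih =>
    rintro v ((rfl | rfl) | hv)
    · exact .inr ⟨_, Multiset.mem_cons_self _ _⟩
    · exact .inl rfl
    · have := ih v hv
      simp only [Multiset.mem_cons]
      grind
  | tensorL _ ih =>
    rintro v (rfl | hv)
    · exact .inr ⟨_, Multiset.mem_cons_self _ _⟩
    · have := ih _ hv
      simp only [Multiset.mem_cons, Prod.mk.injEq, some_mem_lift, Option.some.injEq] at this ⊢
      grind
  | lolliR _ ih =>
    rintro v (rfl | hv)
    · exact .inl rfl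
    · have := ih _ hv
      simp only [Multiset.mem_cons, Prod.mk.injEq, some_mem_lift, Option.some.injEq] at this ⊢
      grind
  | lolliL _ ih =>
    rintro v ((rfl | rfl) | hv)
    · exact .inr ⟨_, Multiset.mem_cons_self _ _⟩
    · exact .inr ⟨_, Multiset.mem_cons_of_mem (Multiset.mem_cons_self _ _)⟩
    · have := ih v hv
      simp only [Multiset.mem_cons, Prod.mk.injEq] at this ⊢
      grind
  | oneR => rintro v rfl; exact .inl rfl
  | oneL _ ih =>
    rintro v (rfl | hv)
    · exact .inr ⟨_, Multiset.mem_cons_self _ _⟩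
    · have := ih v hv
      simp only [Multiset.mem_cons]
      grind
  | tvarR _ _ ih => exact ih
  | tvarL _ _ ih =>
    intro v hv
    have := ih v hv
    simp only [Multiset.mem_cons, Prod.mk.injEq] at this ⊢
    grind
  | spawn _ ih =>
    rintro v (⟨i, rfl⟩ | hv)
    · exact .inr ⟨_, Multiset.mem_add.2 (.inl (Multiset.mem_map.2 ⟨i, by simp, rfl⟩))⟩
    · have := ih _ hv
      simp only [Multiset.mem_cons, Prod.mk.injEq, some_mem_lift, Option.some.injEq,
        Multiset.mem_add] at this ⊢
      grind
  | dfwd =>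
    rintro v (rfl | rfl)
    · exact .inl rfl
    · exact .inr ⟨_, Multiset.mem_singleton_self _⟩

theorem PTyped.ctxEq {V : Type} {Ω Ω' : Multiset (V × Ty Lab TN)} {P : Proc Lab TN ar V} {x : V}
    {A : Ty Lab TN} (h : PTyped S Ω P x A) (he : CtxEq S Ω Ω') : PTyped S Ω' P x A := by
  suffices ∀ Γ, PTyped S (Ω + Γ) P x A → PTyped S (Ω' + Γ) P x A by
    simpa using this 0 (by simpa using h)
  clear h
  induction he with
  | zero => exact fun _ h => h
  | @cons p q Ω Ω' hpq _ ih =>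
    obtain ⟨y, T⟩ := p
    obtain ⟨y', U⟩ := q
    obtain ⟨rfl, hTU⟩ : y = y' ∧ TyEq S T U := hpq
    intro Γ h
    rw [Multiset.cons_add, ← Multiset.add_cons]
    apply ih
    rw [Multiset.add_cons]
    rw [Multiset.cons_add] at h
    exact .tvarL hTU h

/-- `P` is typed by the rule for its outermost constructor; the conversion rules are not used
last. -/
def HeadTyped (S : Sig Lab TN ar) : {V : Type} → Multiset (V × Ty Lab TN) →
    Proc Lab TN ar V → V → Ty Lab TN → Prop
  | _, Ω, .close u, x, A => u = x ∧ Ω = 0 ∧ A = .one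
  | _, Ω, .wait u Q, x, A => ∃ Ω', Ω = (u, .one) ::ₘ Ω' ∧ PTyped S Ω' Q x A
  | _, Ω, .sel u k P, x, A =>
    (u = x ∧ ∃ L B, A = .plus L B ∧ k ∈ L ∧ PTyped S Ω P x (B k)) ∨
    ∃ Ω' L B, Ω = (u, .amp L B) ::ₘ Ω' ∧ k ∈ L ∧ PTyped S ((u, B k) ::ₘ Ω') P x A
  | _, Ω, .case u L Q, x, A =>
    (u = x ∧ ∃ B, A = .amp L B ∧ ∀ k ∈ L, PTyped S Ω (Q k) x (B k)) ∨
    ∃ Ω' B, Ω = (u, .plus L B) ::ₘ Ω' ∧ ∀ k ∈ L, PTyped S ((u, B k) ::ₘ Ω') (Q k) x A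
  | _, Ω, .send z u P, x, A =>
    (u = x ∧ ∃ Ω' A' B, Ω = (z, A') ::ₘ Ω' ∧ A = .tensor A' B ∧ PTyped S Ω' P x B) ∨
    ∃ Ω' A' B, Ω = (z, A') ::ₘ (u, .lolli A' B) ::ₘ Ω' ∧ PTyped S ((u, B) ::ₘ Ω') P x A
  | _, Ω, .recv u P, x, A =>
    (u = x ∧ ∃ A' B, A = .lolli A' B ∧ PTyped S ((none, A') ::ₘ lift Ω) P (some x) B) ∨
    ∃ Ω' A' B, Ω = (u, .tensor A' B) ::ₘ Ω' ∧
      PTyped S ((none, A') ::ₘ (some u, B) ::ₘ lift Ω') P (some x) A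
  | _, Ω, .spawn X γ Q, x, A =>
    ∃ Ω', Ω = Finset.univ.val.map (fun i => (γ i, S.argTy X i)) + Ω' ∧
      PTyped S ((none, S.resTy X) ::ₘ lift Ω') Q (some x) A
  | _, Ω, .fwd Y y z, x, A => y = x ∧ Ω = {(z, .var Y)} ∧ A = .var Y

/-- Inversion: the conversions at the end of a typing derivation amount to changing the types in
the context and the type of the provided channel. -/
theorem PTyped.exists_headTyped (hS : S.WF) {V : Type} {Ω : Multiset (V × Ty Lab TN)}
    {P : Proc Lab TN ar V} {x : V} {A : Ty Lab TN} (h : PTyped S Ω P x A) :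
    ∃ Ω' A', CtxEq S Ω Ω' ∧ TyEq S A' A ∧ HeadTyped S Ω' P x A' := by
  induction h with
  | tvarR hAB _ ih =>
    obtain ⟨Ω', A', h₁, h₂, h₃⟩ := ih
    exact ⟨Ω', A', h₁, h₂.trans hAB, h₃⟩
  | tvarL hAB _ ih =>
    obtain ⟨Ω', A', h₁, h₂, h₃⟩ := ih
    exact ⟨Ω', A', (CtxEq.cons hAB.symm (.refl hS _)).trans h₁, h₂, h₃⟩
  | plusR hk h => exact ⟨_, _, .refl hS _, .refl hS _, .inl ⟨rfl, _, _, rfl, hk, h⟩⟩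
  | plusL h => exact ⟨_, _, .refl hS _, .refl hS _, .inr ⟨_, _, rfl, h⟩⟩
  | ampR h => exact ⟨_, _, .refl hS _, .refl hS _, .inl ⟨rfl, _, rfl, h⟩⟩
  | ampL hk h => exact ⟨_, _, .refl hS _, .refl hS _, .inr ⟨_, _, _, rfl, hk, h⟩⟩
  | tensorR h => exact ⟨_, _, .refl hS _, .refl hS _, .inl ⟨rfl, _, _, _, rfl, rfl, h⟩⟩
  | tensorL h => exact ⟨_, _, .refl hS _, .refl hS _, .inr ⟨_, _, _, rfl, h⟩⟩
  | lolliR h => exact ⟨_, _, .refl hS _, .refl hS _, .inl ⟨rfl, _, _, rfl, h⟩⟩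
  | lolliL h => exact ⟨_, _, .refl hS _, .refl hS _, .inr ⟨_, _, _, rfl, h⟩⟩
  | oneR => exact ⟨_, _, .refl hS _, .refl hS _, rfl, rfl, rfl⟩
  | oneL h => exact ⟨_, _, .refl hS _, .refl hS _, _, rfl, h⟩
  | spawn h => exact ⟨_, _, .refl hS _, .refl hS _, _, rfl, h⟩
  | dfwd => exact ⟨_, _, .refl hS _, .refl hS _, rfl, rfl, rfl⟩

/-- The forwarder of type `C` is the identity expansion at `C`. -/
theorem ptyped_fwder (C : Ty Lab TN) {V : Type} (y z : V) :
    PTyped S {(z, C)} (fwder ar C y z) y C := by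
  induction C generalizing V with
  | one => exact .oneL .oneR
  | plus L A ih => exact .plusL (Ω := 0) fun k hk => .plusR hk (ih k y z)
  | amp L A ih => exact .ampR fun k hk => .ampL (Ω := 0) hk (ih k y z)
  | tensor A B _ ih => exact .tensorL (Ω := 0) (.tensorR (ih (some y) (some z)))
  | lolli A B _ ih =>
    exact .lolliR (.lolliL (Ω := 0) (ih (some y) (some z)))
  | var Y => exact .dfwd

/-! ### Typing of single nodes -/

/-- `Ω ⊢ n :: x : A` for a process or message `n`. -/
inductive NTyped (S : Sig Lab TN ar) : Ctx Lab TN → Node Lab TN ar → Chan → Ty Lab TN → Prop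
  | proc {Ω : Ctx Lab TN} {P : Proc Lab TN ar Chan} {x : Chan} {A : Ty Lab TN}
      (h : PTyped S Ω P x A) : NTyped S Ω (.proc x P) x A
  | msg {Ω : Ctx Lab TN} {M : Msg Lab} {x : Chan} {A : Ty Lab TN}
      (h : MTyped S Ω M x A) : NTyped S Ω (.msg M) x A

theorem NTyped.mem_chans {Ω : Ctx Lab TN} {n : Node Lab TN ar} {x : Chan} {A : Ty Lab TN}
    (h : NTyped S Ω n x A) : x ∈ n.chans := by
  cases h with
  | proc => exact .inl rfl
  | msg h => cases h <;> simp [Node.chans, Msg.chans]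

theorem NTyped.chans_subset {Ω : Ctx Lab TN} {n : Node Lab TN ar} {x : Chan} {A : Ty Lab TN}
    (h : NTyped S Ω n x A) : ∀ c ∈ n.chans, c = x ∨ c ∈ Ctx.dom Ω := by
  cases h with
  | proc h =>
    rintro c (rfl | hc)
    · exact .inl rfl
    · exact h.fn_subset c hc
  | msg h =>
    intro c hc
    cases h <;>
      simp only [Node.chans, Msg.chans, Set.mem_insert_iff, Set.mem_singleton_iff] at hc <;>
      simp only [hc, Multiset.insert_eq_cons, Ctx.dom_cons, Ctx.dom_singleton, Set.mem_insert_iff,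
        Set.mem_singleton_iff, true_or] <;> tauto

theorem MTyped.tyEq (hS : S.WF) {Ω : Ctx Lab TN} {M : Msg Lab} {x : Chan} {A B : Ty Lab TN}
    (h : MTyped S Ω M x A) (hAB : TyEq S A B) : MTyped S Ω M x B := by
  cases h with
  | plusR hT hU hk => exact .plusR (hAB.symm.trans hT) hU hk
  | ampL hT hU hk => exact .ampL hT (hAB.symm.trans hU) hk
  | tensorR hT => exact .tensorR (hAB.symm.trans hT)
  | lolliL hT =>
    exact .lolliL (hT.trans (.of_head (.lolli (.refl hS _) hAB)))
  | oneR hT => exact .oneR (hAB.symm.trans hT)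

/-! ### Sequential presentation of configuration typing -/

/-- The channels of a configuration and of the context of channels it uses. -/
def chansOf (Δ₀ : Ctx Lab TN) (C : Config Lab TN ar) : Set Chan :=
  Ctx.dom Δ₀ ∪ Config.chans C

theorem Config.chans_zero : Config.chans (0 : Config Lab TN ar) = ∅ := by
  simp [Config.chans]

theorem Config.chans_cons (n : Node Lab TN ar) (C : Config Lab TN ar) :
    Config.chans (n ::ₘ C) = n.chans ∪ Config.chans C := by
  ext c
  simp [Config.chans]

theorem Config.chans_add (C C' : Config Lab TN ar) :
    Config.chans (C + C') = Config.chans C ∪ Config.chans C' := by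
  ext c
  simp only [Config.chans, Multiset.mem_add, Set.mem_ofPred_eq, Set.mem_union]
  grind

theorem mem_chansOf {Δ₀ : Ctx Lab TN} {C : Config Lab TN ar} {c : Chan} :
    c ∈ chansOf Δ₀ C ↔ c ∈ Ctx.dom Δ₀ ∨ c ∈ Config.chans C := Iff.rfl

theorem mem_chans_cons {n : Node Lab TN ar} {C : Config Lab TN ar} {c : Chan} :
    c ∈ Config.chans (n ::ₘ C) ↔ c ∈ n.chans ∨ c ∈ Config.chans C := by
  rw [Config.chans_cons]; rfl

theorem mem_chans_add {C C' : Config Lab TN ar} {c : Chan} :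
    c ∈ Config.chans (C + C') ↔ c ∈ Config.chans C ∨ c ∈ Config.chans C' := by
  rw [Config.chans_add]; rfl

theorem not_mem_chans_zero {c : Chan} : c ∉ Config.chans (0 : Config Lab TN ar) := by
  rw [Config.chans_zero]; exact id

/-- A presentation of `Δ₀ ⊩ C :: Δ` in which the forest is built one node at a time, each node
consuming part of the channels provided so far. Unlike in a derivation of `CTyped`, a
configuration can be cut at any node into an initial and a final segment, both of them typed. -/
inductive SeqTyped (S : Sig Lab TN ar) : Ctx Lab TN → Config Lab TN ar → Ctx Lab TN → Prop
  | id {Δ : Ctx Lab TN} (hn : Ctx.Linear Δ) : SeqTyped S Δ 0 Δ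
  | conv {Δ₀ Δ Δ' : Ctx Lab TN} {C : Config Lab TN ar} (h : SeqTyped S Δ₀ C Δ)
      (he : CtxEq S Δ Δ') : SeqTyped S Δ₀ C Δ'
  | cons {Δ₀ Ω Δ : Ctx Lab TN} {C : Config Lab TN ar} {n : Node Lab TN ar} {x : Chan}
      {A : Ty Lab TN} (h : SeqTyped S Δ₀ C (Ω + Δ)) (hn : NTyped S Ω n x A)
      (hx : x ∉ chansOf Δ₀ C) : SeqTyped S Δ₀ (n ::ₘ C) ((x, A) ::ₘ Δ)

namespace SeqTyped

theorem linear_left {Δ₀ Δ : Ctx Lab TN} {C : Config Lab TN ar} (h : SeqTyped S Δ₀ C Δ) :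
    Ctx.Linear Δ₀ := by
  induction h with
  | id hn => exact hn
  | conv _ _ ih => exact ih
  | cons _ _ _ ih => exact ih

theorem dom_subset {Δ₀ Δ : Ctx Lab TN} {C : Config Lab TN ar} (h : SeqTyped S Δ₀ C Δ) :
    ∀ c ∈ Ctx.dom Δ, c ∈ chansOf Δ₀ C := by
  induction h with
  | id hn => exact fun c hc => .inl hc
  | conv _ he ih => rwa [← he.dom]
  | cons _ hn _ ih =>
    intro c hc
    have := hn.mem_chans
    simp only [Ctx.mem_dom_cons, Ctx.mem_dom_add, mem_chansOf, mem_chans_cons] at *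
    grind

theorem linear_right {Δ₀ Δ : Ctx Lab TN} {C : Config Lab TN ar} (h : SeqTyped S Δ₀ C Δ) :
    Ctx.Linear Δ := by
  induction h with
  | id hn => exact hn
  | conv _ he ih => exact he.linear ih
  | cons h _ hx ih =>
    have := h.dom_subset
    simp only [Ctx.linear_cons, Ctx.linear_add, Ctx.mem_dom_add] at *
    grind

/-- Channels that do not occur in a configuration can be passed through it unused. -/
theorem frame (hS : S.WF) {Δ₀ Δ Γ : Ctx Lab TN} {C : Config Lab TN ar}
    (h : SeqTyped S Δ₀ C Δ) (hΓ : Ctx.Linear Γ) (hd : ∀ c ∈ Ctx.dom Γ, c ∉ chansOf Δ₀ C) :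
    SeqTyped S (Δ₀ + Γ) C (Δ + Γ) := by
  induction h with
  | id hn =>
    refine .id (Ctx.linear_add.2 ⟨hn, hΓ, fun c hc hc' => hd c hc' (.inl hc)⟩)
  | conv _ he ih => exact .conv (ih hd) (Multiset.Rel.add he (CtxEq.refl hS Γ))
  | cons h hn hx ih =>
    have hm := hn.mem_chans
    rw [Multiset.cons_add]
    refine .cons (add_assoc _ _ Γ ▸ ih ?_) hn ?_ <;>
      simp only [mem_chansOf, mem_chans_cons, Ctx.mem_dom_add] at * <;> grind

theorem comp {Δ₀ Δ₁ Δ₂ : Ctx Lab TN} {C C' : Config Lab TN ar} (h : SeqTyped S Δ₀ C Δ₁)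
    (h' : SeqTyped S Δ₁ C' Δ₂)
    (hd : ∀ c ∈ chansOf Δ₀ C, c ∈ chansOf Δ₁ C' → c ∈ Ctx.dom Δ₁) :
    SeqTyped S Δ₀ (C + C') Δ₂ := by
  induction h' with
  | id hn => simpa using h
  | conv _ he ih => exact .conv (ih hd) he
  | cons h' hn hx ih =>
    have hm := hn.mem_chans
    rw [Multiset.add_cons]
    refine .cons (ih fun c hc hc' => hd c hc ?_) hn ?_ <;>
      simp only [mem_chansOf, mem_chans_cons, mem_chans_add] at * <;> grind

/-- Conversely, a channel both used and provided has been passed through: it does not occur in the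
configuration and can be dropped. By freshness of provided channels it cannot have been consumed
and provided again. -/
theorem unframe {Δ₀ Δ : Ctx Lab TN} {C : Config Lab TN ar} {y : Chan} {T T' : Ty Lab TN}
    (h : SeqTyped S ((y, T) ::ₘ Δ₀) C ((y, T') ::ₘ Δ)) (hS : S.WF) :
    TyEq S T T' ∧ SeqTyped S Δ₀ C Δ ∧ y ∉ chansOf Δ₀ C := by
  generalize hΔ : (y, T') ::ₘ Δ = Δ' at h
  induction h generalizing Δ T' with
  | id hn =>
    obtain ⟨rfl, rfl⟩ := hn.cons_inj hΔ.symm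
    obtain ⟨h₁, h₂⟩ := Ctx.linear_cons.1 hn
    exact ⟨.refl hS _, .id h₂, by simpa [mem_chansOf, not_mem_chans_zero] using h₁⟩
  | conv _ he ih =>
    subst hΔ
    obtain ⟨T₁, Δ₁, rfl, h₁, h₂⟩ := he.cons_right
    obtain ⟨h₃, h₄, h₅⟩ := ih rfl
    exact ⟨h₃.trans h₁, .conv h₄ h₂, h₅⟩
  | @cons Ω Θ C n x A h hn hx ih =>
    have hxy : y ≠ x := by
      rintro rfl
      exact hx (.inl (Ctx.mem_dom_cons.2 (.inl rfl)))
    rcases Multiset.cons_eq_cons.1 hΔ with ⟨h₁, -⟩ | ⟨-, Θ', rfl, rfl⟩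
    · exact absurd (Prod.ext_iff.1 h₁).1 hxy
    · obtain ⟨h₃, h₄, h₅⟩ := ih (T' := T') (Δ := Ω + Θ') (by rw [Multiset.add_cons])
      have hl := h.linear_right
      have hc := hn.chans_subset
      rw [Multiset.add_cons, Ctx.linear_cons] at hl
      refine ⟨h₃, .cons h₄ hn fun hc => hx ?_, ?_⟩ <;>
        simp only [mem_chansOf, mem_chans_cons, Ctx.mem_dom_cons, Ctx.mem_dom_add] at * <;> grind

theorem eq_zero {Δ₀ Δ : Ctx Lab TN} {C : Config Lab TN ar} (h : SeqTyped S Δ₀ C Δ)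
    (hΔ : Δ = 0) : Δ₀ = 0 ∧ C = 0 := by
  induction h with
  | id => exact ⟨hΔ, rfl⟩
  | conv _ he ih =>
    subst hΔ
    exact ih (CtxEq.zero_right he)
  | cons => exact absurd hΔ Multiset.cons_ne_zero

end SeqTyped

theorem chansOf_add (Δ Δ' : Ctx Lab TN) (C C' : Config Lab TN ar) :
    chansOf (Δ + Δ') (C + C') = chansOf Δ C ∪ chansOf Δ' C' := by
  ext c
  simp only [mem_chansOf, Ctx.mem_dom_add, mem_chans_add, Set.mem_union]
  tauto

/-- A configuration providing `Δa, Δb` is the juxtaposition of one providing `Δa` and one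
providing `Δb`. -/
theorem SeqTyped.split {Δ₀ Δa Δb : Ctx Lab TN} {C : Config Lab TN ar}
    (h : SeqTyped S Δ₀ C (Δa + Δb)) :
    ∃ Γa Γb Ca Cb, Δ₀ = Γa + Γb ∧ C = Ca + Cb ∧ SeqTyped S Γa Ca Δa ∧ SeqTyped S Γb Cb Δb ∧
      Disjoint (chansOf Γa Ca) (chansOf Γb Cb) := by
  generalize hΔ : Δa + Δb = Δ at h
  induction h generalizing Δa Δb with
  | id hn =>
    subst hΔ
    obtain ⟨h₁, h₂, h₃⟩ := Ctx.linear_add.1 hn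
    refine ⟨Δa, Δb, 0, 0, rfl, rfl, .id h₁, .id h₂, Set.disjoint_left.2 ?_⟩
    simpa [mem_chansOf, not_mem_chans_zero] using h₃
  | conv _ he ih =>
    subst hΔ
    obtain ⟨Δa', Δb', ha, hb, rfl⟩ := Multiset.rel_add_right.1 he
    obtain ⟨Γa, Γb, Ca, Cb, h₁, h₂, h₃, h₄, h₅⟩ := ih rfl
    exact ⟨Γa, Γb, Ca, Cb, h₁, h₂, .conv h₃ ha, .conv h₄ hb, h₅⟩
  | @cons Ω Θ C n x A h hn hx ih =>
    -- The new node belongs to the part whose context contains the channel it provides.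
    have key : ∀ {Δa Δb : Ctx Lab TN}, Θ = Δa + Δb →
        ∃ Γa Γb Ca Cb, Δ₀ = Γa + Γb ∧ n ::ₘ C = Ca + Cb ∧
          SeqTyped S Γa Ca ((x, A) ::ₘ Δa) ∧ SeqTyped S Γb Cb Δb ∧
          Disjoint (chansOf Γa Ca) (chansOf Γb Cb) := by
      rintro Δa Δb rfl
      obtain ⟨Γa, Γb, Ca, Cb, rfl, rfl, h₃, h₄, h₅⟩ := ih (add_assoc Ω Δa Δb)
      rw [chansOf_add] at hx
      refine ⟨Γa, Γb, n ::ₘ Ca, Cb, rfl, by rw [Multiset.cons_add], .cons h₃ hn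
        fun hc => hx (.inl hc), h₄, ?_⟩
      have hc := hn.chans_subset
      have hs := h₃.dom_subset
      rw [Set.disjoint_left] at *
      simp only [mem_chansOf, mem_chans_cons, Ctx.mem_dom_add, Set.mem_union] at *
      grind
    have hmem : (x, A) ∈ Δa + Δb := hΔ ▸ Multiset.mem_cons_self _ _
    rcases Multiset.mem_add.1 hmem with hm | hm
    · obtain ⟨Δa', rfl⟩ := Multiset.exists_cons_of_mem hm
      rw [Multiset.cons_add, Multiset.cons_inj_right] at hΔ
      exact key hΔ.symm
    · obtain ⟨Δb', rfl⟩ := Multiset.exists_cons_of_mem hm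
      rw [Multiset.add_cons, Multiset.cons_inj_right, add_comm] at hΔ
      obtain ⟨Γa, Γb, Ca, Cb, h₁, h₂, h₃, h₄, h₅⟩ := key hΔ.symm
      exact ⟨Γb, Γa, Cb, Ca, h₁.trans (add_comm _ _), h₂.trans (add_comm _ _), h₄, h₃, h₅.symm⟩

/-- Juxtaposition. -/
theorem SeqTyped.par (hS : S.WF) {Δ Δ' Γ Γ' : Ctx Lab TN} {C C' : Config Lab TN ar}
    (h : SeqTyped S Γ C Δ) (h' : SeqTyped S Γ' C' Δ')
    (hd : Disjoint (chansOf Γ C) (chansOf Γ' C')) :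
    SeqTyped S (Γ + Γ') (C + C') (Δ + Δ') := by
  have hs := h.dom_subset
  have hs' := h'.dom_subset
  rw [Set.disjoint_left] at hd
  have h₁ := h.frame hS h'.linear_left fun c hc hc' => hd hc' (.inl hc)
  have h₂ := h'.frame hS h.linear_right fun c hc hc' => hd (hs c hc) hc'
  rw [add_comm, add_comm Δ' Δ] at h₂
  refine h₁.comp h₂ ?_
  simp only [mem_chansOf, Ctx.mem_dom_add] at *
  grind

/-! ### Cutting a configuration at a node -/

/-- `C` with one node `n` added is an initial segment `C₁`, the node, and a final segment `C₂`.
The segments share only the channels on which they are composed. -/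
inductive CutAt (S : Sig Lab TN ar) (Δ₀ : Ctx Lab TN) (n : Node Lab TN ar)
    (C : Config Lab TN ar) (Δ : Ctx Lab TN) : Prop
  | mk {C₁ C₂ : Config Lab TN ar} {Ω Γ : Ctx Lab TN} {x : Chan} {A : Ty Lab TN}
      (hC : C = C₁ + C₂) (h₁ : SeqTyped S Δ₀ C₁ (Ω + Γ)) (hn : NTyped S Ω n x A)
      (hx : x ∉ chansOf Δ₀ C₁) (h₂ : SeqTyped S ((x, A) ::ₘ Γ) C₂ Δ)
      (hd : ∀ c ∈ chansOf Δ₀ (n ::ₘ C₁), c ∈ chansOf ((x, A) ::ₘ Γ) C₂ →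
        c ∈ Ctx.dom ((x, A) ::ₘ Γ))

theorem SeqTyped.cut {Δ₀ Δ : Ctx Lab TN} {C : Config Lab TN ar} {n : Node Lab TN ar}
    (h : SeqTyped S Δ₀ (n ::ₘ C) Δ) : CutAt S Δ₀ n C Δ := by
  generalize hD : n ::ₘ C = D at h
  induction h generalizing C with
  | id => exact absurd hD.symm Multiset.zero_ne_cons
  | conv _ he ih =>
    obtain ⟨hC, h₁, hn, hx, h₂, hd⟩ := ih hD
    exact ⟨hC, h₁, hn, hx, .conv h₂ he, hd⟩
  | @cons Ω Δ D n' x A h hn hx ih =>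
    rcases Multiset.cons_eq_cons.1 hD with ⟨rfl, rfl⟩ | ⟨-, C', rfl, rfl⟩
    · have hl := (SeqTyped.cons h hn hx).linear_right
      exact ⟨(add_zero C).symm, h, hn, hx, .id hl,
        fun c _ hc => hc.resolve_right not_mem_chans_zero⟩
    · obtain @⟨C₁, C₂, Ω', Γ, x', A', rfl, h₁, hn', hx', h₂, hd⟩ := ih rfl
      have hs₁ := h₁.dom_subset
      have hs₂ := h₂.dom_subset
      have hc := hn.chans_subset
      have hm := hn'.mem_chans
      refine ⟨(Multiset.add_cons _ _ _).symm, h₁, hn', hx', .cons h₂ hn ?_, ?_⟩ <;>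
        simp only [mem_chansOf, mem_chans_cons, mem_chans_add, Ctx.mem_dom_cons,
          Ctx.mem_dom_add] at * <;> grind

/-- The node `a` provides the channel `y` to the node `b`. The remaining nodes can be arranged so
that `a` and `b` are adjacent, and `y` occurs in none of them. -/
inductive Linked (S : Sig Lab TN ar) (Δ₀ : Ctx Lab TN) (a b : Node Lab TN ar)
    (C : Config Lab TN ar) (Δ : Ctx Lab TN) (y : Chan) : Prop
  | mk {C₁ C₂ : Config Lab TN ar} {Ωa Ωb Γ : Ctx Lab TN} {x : Chan} {A A' B : Ty Lab TN}
      (hC : C = C₁ + C₂) (h₁ : SeqTyped S Δ₀ C₁ (Ωa + (Ωb + Γ))) (ha : NTyped S Ωa a y A)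
      (hA : TyEq S A A') (hb : NTyped S ((y, A') ::ₘ Ωb) b x B) (hy : y ∉ chansOf Δ₀ C₁)
      (hx : x ∉ chansOf Δ₀ C₁) (hyx : y ≠ x) (h₂ : SeqTyped S ((x, B) ::ₘ Γ) C₂ Δ)
      (hy₂ : y ∉ chansOf ((x, B) ::ₘ Γ) C₂)
      (hd : ∀ c ∈ chansOf Δ₀ C₁, c ∈ chansOf ((x, B) ::ₘ Γ) C₂ → c ∈ Ctx.dom ((x, B) ::ₘ Γ))

theorem Linked.of_segments (hS : S.WF) {Δ₀ Δ Ωa Ωb Γ Γ' : Ctx Lab TN}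
    {C₁ C₂ C₃ : Config Lab TN ar} {a b : Node Lab TN ar} {x x' y : Chan} {A B : Ty Lab TN}
    (h₁ : SeqTyped S Δ₀ C₁ (Ωa + Γ)) (ha : NTyped S Ωa a x A) (hx : x ∉ chansOf Δ₀ C₁)
    (h₂ : SeqTyped S ((x, A) ::ₘ Γ) C₂ (Ωb + Γ')) (hb : NTyped S Ωb b x' B)
    (hx' : x' ∉ chansOf Δ₀ (C₁ + a ::ₘ C₂)) (h₃ : SeqTyped S ((x', B) ::ₘ Γ') C₃ Δ)
    (hd₂ : ∀ c ∈ chansOf Δ₀ (a ::ₘ C₁), c ∈ chansOf ((x, A) ::ₘ Γ) C₂ →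
      c ∈ Ctx.dom ((x, A) ::ₘ Γ))
    (hd₃ : ∀ c ∈ chansOf Δ₀ (b ::ₘ (C₁ + a ::ₘ C₂)), c ∈ chansOf ((x', B) ::ₘ Γ') C₃ →
      c ∈ Ctx.dom ((x', B) ::ₘ Γ'))
    (hya : y ∈ a.chans) (hyb : y ∈ b.chans) :
    Linked S Δ₀ a b (C₁ + C₂ + C₃) Δ y := by
  have hs₁ := h₁.dom_subset
  have hs₂ := h₂.dom_subset
  have hca := ha.chans_subset
  have hcb := hb.chans_subset
  have hma := ha.mem_chans
  have hmb := hb.mem_chans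
  have hl₁ := Ctx.linear_add.1 h₁.linear_right
  have hl₂ := Ctx.linear_add.1 h₂.linear_right
  have hl₃ := Ctx.linear_cons.1 h₃.linear_left
  have hyΩb : y ∈ Ctx.dom Ωb := by
    simp only [mem_chansOf, mem_chans_cons, mem_chans_add] at *
    grind
  obtain rfl : y = x := by
    simp only [mem_chansOf, mem_chans_cons, mem_chans_add, Ctx.mem_dom_cons,
      Ctx.mem_dom_add] at *
    grind
  obtain ⟨A', Ωb, rfl⟩ := Ctx.exists_cons_of_mem_dom hyΩb
  rw [Multiset.cons_add] at h₂
  obtain ⟨hA, h₂', hy₂⟩ := h₂.unframe hS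
  have hl : Ctx.Linear Ωa := hl₁.1
  have h₄ := h₂'.frame hS hl fun c hc hc' => by
    simp only [mem_chansOf, mem_chans_cons, mem_chans_add, Ctx.mem_dom_cons,
      Ctx.mem_dom_add] at *
    grind
  rw [add_comm Γ, add_comm _ Ωa] at h₄
  have hs₂' := h₂'.dom_subset
  refine ⟨rfl, h₁.comp h₄ ?_, ha, hA, hb, ?_, ?_, ?_, h₃, ?_, ?_⟩ <;>
    simp only [mem_chansOf, mem_chans_cons, mem_chans_add, Ctx.mem_dom_cons,
      Ctx.mem_dom_add, Ctx.linear_cons] at * <;> grind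

/-- Linearity: a channel that occurs in two nodes is provided by one of them and used by the
other. -/
theorem SeqTyped.linked (hS : S.WF) {Δ₀ Δ : Ctx Lab TN} {C : Config Lab TN ar}
    {a b : Node Lab TN ar} {y : Chan} (h : SeqTyped S Δ₀ (a ::ₘ b ::ₘ C) Δ) (ha : y ∈ a.chans)
    (hb : y ∈ b.chans) : Linked S Δ₀ a b C Δ y ∨ Linked S Δ₀ b a C Δ y := by
  obtain @⟨C₁, C₂, Ω, Γ, x, A, hC, h₁, hn, hx, h₂, hd⟩ := h.cut
  have hm := hn.mem_chans
  have hs₁ := h₁.dom_subset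
  have hbC : b ∈ C₁ + C₂ := hC ▸ Multiset.mem_cons_self _ _
  rcases Multiset.mem_add.1 hbC with hbC | hbC
  · right
    obtain ⟨C₁, rfl⟩ := Multiset.exists_cons_of_mem hbC
    rw [Multiset.cons_add, Multiset.cons_inj_right] at hC
    obtain @⟨E₁, E₂, Ω', Γ', x', B, rfl, g₁, gn, gx, g₂, gd⟩ := h₁.cut
    subst hC
    refine .of_segments hS g₁ gn gx g₂ hn ?_ h₂ gd ?_ hb ha <;>
      simp only [mem_chansOf, mem_chans_cons, mem_chans_add, Ctx.mem_dom_cons,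
        Ctx.mem_dom_add] at * <;> grind
  · left
    obtain ⟨C₂, rfl⟩ := Multiset.exists_cons_of_mem hbC
    rw [Multiset.add_cons, Multiset.cons_inj_right] at hC
    obtain @⟨E₁, E₂, Ω', Γ', x', B, rfl, g₁, gn, gx, g₂, gd⟩ := h₂.cut
    rw [← add_assoc] at hC
    subst hC
    have gm := gn.mem_chans
    have gs₁ := g₁.dom_subset
    refine .of_segments hS h₁ hn hx g₁ gn ?_ g₂ ?_ ?_ ha hb <;>
      simp only [mem_chansOf, mem_chans_cons, mem_chans_add, Ctx.mem_dom_cons,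
        Ctx.mem_dom_add] at * <;> grind

/-- A channel that occurs in two nodes does not belong to the interface. -/
theorem Linked.not_mem {Δ₀ Δ : Ctx Lab TN} {C : Config Lab TN ar} {a b : Node Lab TN ar}
    {y : Chan} (h : Linked S Δ₀ a b C Δ y) : y ∉ Ctx.dom Δ₀ ∧ y ∉ Ctx.dom Δ := by
  obtain ⟨-, -, -, -, -, hy, -, -, h₂, hy₂, -⟩ := h
  exact ⟨fun hc => hy (.inl hc), fun hc => hy₂ (h₂.dom_subset _ hc)⟩

theorem Linked.left_proc {Δ₀ Δ : Ctx Lab TN} {C : Config Lab TN ar} {u y : Chan}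
    {P : Proc Lab TN ar Chan} {b : Node Lab TN ar} (h : Linked S Δ₀ (.proc u P) b C Δ y) :
    u = y := by
  obtain ⟨-, -, ha, -, -, -, -, -, -, -, -⟩ := h
  cases ha
  rfl

theorem Linked.right_proc {Δ₀ Δ : Ctx Lab TN} {C : Config Lab TN ar} {u y : Chan}
    {P : Proc Lab TN ar Chan} {a : Node Lab TN ar} (h : Linked S Δ₀ a (.proc u P) C Δ y) :
    y ≠ u := by
  obtain ⟨-, -, -, -, hb, -, -, hyx, -, -, -⟩ := h
  cases hb
  exact hyx

/-! ### Replacing nodes -/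

theorem SeqTyped.replace {Δ₀ Δ : Ctx Lab TN} {C : Config Lab TN ar} {n n' : Node Lab TN ar}
    (h : SeqTyped S Δ₀ (n ::ₘ C) Δ)
    (hn' : ∀ Ω x A, Ctx.Linear ((x, A) ::ₘ Ω) → NTyped S Ω n x A → NTyped S Ω n' x A) :
    SeqTyped S Δ₀ (n' ::ₘ C) Δ ∧ ∀ c ∈ chansOf Δ₀ (n' ::ₘ C), c ∈ chansOf Δ₀ (n ::ₘ C) := by
  obtain @⟨C₁, C₂, Ω, Γ, x, A, rfl, h₁, hn, hx, h₂, hd⟩ := h.cut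
  have hs₁ := h₁.dom_subset
  have hm := hn.mem_chans
  have hl := (Ctx.linear_add.1 h₁.linear_right).1
  have hn' := hn' Ω x A (Ctx.linear_cons.2
    ⟨fun hc => hx (hs₁ _ (Ctx.mem_dom_add.2 (.inl hc))), hl⟩) hn
  have hc' := hn'.chans_subset
  rw [← Multiset.cons_add]
  refine ⟨(SeqTyped.cons h₁ hn' hx).comp h₂ ?_, ?_⟩ <;>
    simp only [mem_chansOf, mem_chans_cons, mem_chans_add, Ctx.mem_dom_cons,
      Ctx.mem_dom_add] at * <;> grind

/-- Replacement of a node by two nodes, the first of which provides a new channel `z` to the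
second. -/
theorem SeqTyped.replace_two {Δ₀ Δ : Ctx Lab TN} {C : Config Lab TN ar}
    {n n₁ n₂ : Node Lab TN ar} {z : Chan} (hS : S.WF)
    (h : SeqTyped S Δ₀ (n ::ₘ C) Δ) (hz : z ∉ chansOf Δ₀ (n ::ₘ C))
    (hn' : ∀ Ω x A, Ctx.Linear ((x, A) ::ₘ Ω) → NTyped S Ω n x A →
      ∃ Ω₁ Ω₂ U, CtxEq S Ω (Ω₁ + Ω₂) ∧ NTyped S Ω₁ n₁ z U ∧ NTyped S ((z, U) ::ₘ Ω₂) n₂ x A) :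
    SeqTyped S Δ₀ (n₂ ::ₘ n₁ ::ₘ C) Δ ∧
      ∀ c ∈ chansOf Δ₀ (n₂ ::ₘ n₁ ::ₘ C), c = z ∨ c ∈ chansOf Δ₀ (n ::ₘ C) := by
  obtain @⟨C₁, C₂, Ω, Γ, x, A, rfl, h₁, hn, hx, h₂, hd⟩ := h.cut
  have hs₁ := h₁.dom_subset
  have hs₂ := h₂.dom_subset
  have hm := hn.mem_chans
  have hl := (Ctx.linear_add.1 h₁.linear_right).1
  obtain ⟨Ω₁, Ω₂, U, he, hn₁, hn₂⟩ := hn' Ω x A (Ctx.linear_cons.2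
    ⟨fun hc => hx (hs₁ _ (Ctx.mem_dom_add.2 (.inl hc))), hl⟩) hn
  have hdom := he.dom
  have hc₁ := hn₁.chans_subset
  have hc₂ := hn₂.chans_subset
  have h₃ := SeqTyped.conv h₁ (Multiset.Rel.add he (CtxEq.refl hS Γ))
  rw [add_assoc] at h₃
  have h₄ := SeqTyped.cons h₃ hn₁ (by
    simp only [mem_chansOf, mem_chans_cons, mem_chans_add] at *; grind)
  rw [← Multiset.cons_add] at h₄
  have hs : ∀ c, c ∈ Ctx.dom Ω ↔ c ∈ Ctx.dom Ω₁ ∨ c ∈ Ctx.dom Ω₂ := fun c => by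
    rw [hdom, Ctx.mem_dom_add]
  have h₅ := SeqTyped.cons h₄ hn₂ (by
    simp only [mem_chansOf, mem_chans_cons, mem_chans_add, Ctx.mem_dom_add] at *; grind)
  rw [← Multiset.cons_add, ← Multiset.cons_add]
  refine ⟨h₅.comp h₂ ?_, ?_⟩ <;>
    simp only [mem_chansOf, mem_chans_cons, mem_chans_add, Ctx.mem_dom_cons,
      Ctx.mem_dom_add] at * <;> grind

/-- Replacement of two nodes sharing the channel `y` by a single one, after which `y` no longer
occurs. -/
theorem Linked.replace {Δ₀ Δ : Ctx Lab TN} {C : Config Lab TN ar} {a b n : Node Lab TN ar}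
    {y : Chan} (h : Linked S Δ₀ a b C Δ y)
    (hn : ∀ Ωa Ωb A A' x B, Ctx.Linear (Ωa + Ωb) → y ∉ Ctx.dom Ωa → y ∉ Ctx.dom Ωb → y ≠ x →
      x ∉ Ctx.dom Ωa → x ∉ Ctx.dom Ωb → NTyped S Ωa a y A → TyEq S A A' →
      NTyped S ((y, A') ::ₘ Ωb) b x B → NTyped S (Ωa + Ωb) n x B) :
    SeqTyped S Δ₀ (n ::ₘ C) Δ ∧ y ∉ chansOf Δ₀ (n ::ₘ C) ∧
      ∀ c ∈ chansOf Δ₀ (n ::ₘ C), c ∈ chansOf Δ₀ (a ::ₘ b ::ₘ C) := by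
  obtain @⟨C₁, C₂, Ωa, Ωb, Γ, x, A, A', B, rfl, h₁, ha, hA, hb, hy, hx, hyx, h₂, hy₂, hd⟩ := h
  have hs₁ := h₁.dom_subset
  have hmb := hb.mem_chans
  rw [← add_assoc] at h₁
  have hl := (Ctx.linear_add.1 h₁.linear_right).1
  simp only [Ctx.mem_dom_add] at hs₁
  have hn := hn Ωa Ωb A A' x B hl (fun hc => hy (hs₁ y (.inl hc)))
    (fun hc => hy (hs₁ y (.inr (.inl hc)))) hyx (fun hc => hx (hs₁ x (.inl hc)))
    (fun hc => hx (hs₁ x (.inr (.inl hc)))) ha hA hb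
  have hc := hn.chans_subset
  rw [← Multiset.cons_add]
  refine ⟨(SeqTyped.cons h₁ hn hx).comp h₂ ?_, ?_, ?_⟩ <;>
    simp only [mem_chansOf, mem_chans_cons, mem_chans_add, Ctx.mem_dom_cons,
      Ctx.mem_dom_add] at * <;> grind

/-! ### Agreement with the typing of configurations -/

theorem names_eq_chansOf {Δ₀ Δ : Ctx Lab TN} {C : Config Lab TN ar} (h : SeqTyped S Δ₀ C Δ) :
    names Δ₀ C Δ = chansOf Δ₀ C :=
  Set.union_eq_self_of_subset_right h.dom_subset

theorem CTyped.seqTyped (hS : S.WF) {Δ₀ Δ : Ctx Lab TN} {C : Config Lab TN ar}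
    (h : CTyped S Δ₀ C Δ) : SeqTyped S Δ₀ C Δ := by
  have key : ∀ {Δ₀ Δ₀' Δ : Ctx Lab TN} {C : Config Lab TN ar} {x : Chan} {A : Ty Lab TN}
      {n : Node Lab TN ar}, SeqTyped S Δ₀ C Δ → NTyped S (Δ₀' + Δ) n x A →
      (((x, A) ::ₘ Δ₀').map Prod.fst).Nodup →
      Disjoint (Ctx.dom ((x, A) ::ₘ Δ₀')) (names Δ₀ C Δ) →
      SeqTyped S (Δ₀ + Δ₀') (n ::ₘ C) {(x, A)} := by
    intro Δ₀ Δ₀' Δ C x A n h hn hl hd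
    rw [names_eq_chansOf h, Set.disjoint_left] at hd
    have hl := Ctx.linear_cons.1 hl
    have h' := h.frame hS hl.2 fun c hc => hd (Ctx.mem_dom_cons.2 (.inr hc))
    rw [add_comm Δ] at h'
    have hx : x ∉ chansOf (Δ₀ + Δ₀') C := by
      simp only [mem_chansOf, Ctx.mem_dom_add, Ctx.mem_dom_cons] at *
      grind
    exact .cons (Δ := 0) (by simpa using h') hn hx
  induction h with
  | emp₁ hAB => exact .conv (.id (Ctx.linear_singleton _)) (CtxEq.cons hAB .zero)
  | emp₂ => exact .id Ctx.linear_zero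
  | @comp Δ₀ Δ₀' Δ C C₁ x A _ _ hd ih ih₁ =>
    rw [names_eq_chansOf ih, names_eq_chansOf ih₁] at hd
    have := SeqTyped.par hS ih ih₁ hd
    rwa [add_comm Δ, Multiset.singleton_add] at this
  | proc _ hP hn hd ih => exact key ih (.proc hP) hn hd
  | msg _ hM hn hd ih => exact key ih (.msg hM) hn hd

/-- Conversion of the provided types, which in `CTyped` is only built into the rules for
`x : A ⊩ · :: x : B`, processes and messages. -/
theorem CTyped.conv (hS : S.WF) {Δ₀ Δ Δ' : Ctx Lab TN} {C : Config Lab TN ar}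
    (h : CTyped S Δ₀ C Δ) (he : CtxEq S Δ Δ') : CTyped S Δ₀ C Δ' := by
  have single : ∀ {x : Chan} {A : Ty Lab TN} {Δ' : Ctx Lab TN}, CtxEq S {(x, A)} Δ' →
      ∃ B, Δ' = {(x, B)} ∧ TyEq S A B := by
    intro x A Δ' h
    obtain ⟨⟨x', B⟩, Δ'', ⟨h₁, h₂⟩, h₃, rfl⟩ := Multiset.rel_cons_left.1 h
    obtain rfl : x = x' := h₁
    rw [Multiset.rel_zero_left.1 h₃]
    exact ⟨B, rfl, h₂⟩
  induction h generalizing Δ' with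
  | emp₁ hAB =>
    obtain ⟨B, rfl, h⟩ := single he
    exact .emp₁ (hAB.trans h)
  | emp₂ =>
    rw [Multiset.rel_zero_left.1 he]
    exact .emp₂
  | comp _ _ hd ih ih₁ =>
    obtain ⟨⟨x', B⟩, Δ'', ⟨h₁, h₂⟩, h₃, rfl⟩ := Multiset.rel_cons_left.1 he
    obtain rfl := h₁
    refine .comp (ih h₃) (ih₁ (CtxEq.cons h₂ .zero)) ?_
    have := CtxEq.dom h₃
    simpa [names, Ctx.dom_singleton, this] using hd
  | proc hC hP hn hd ih =>
    obtain ⟨B, rfl, h⟩ := single he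
    exact .proc hC (.tvarR h hP) (by simpa using hn) (by simpa [Ctx.dom_cons] using hd)
  | msg hC hM hn hd ih =>
    obtain ⟨B, rfl, h⟩ := single he
    exact .msg hC (hM.tyEq hS h) (by simpa using hn) (by simpa [Ctx.dom_cons] using hd)

theorem CTyped.id (hS : S.WF) {Δ : Ctx Lab TN} (h : Ctx.Linear Δ) :
    CTyped S Δ (0 : Config Lab TN ar) Δ := by
  induction Δ using Multiset.induction with
  | empty => exact .emp₂
  | cons p Δ ih =>
    obtain ⟨h₁, h₂⟩ := Ctx.linear_cons.1 h
    have := CTyped.comp (ih h₂) (.emp₁ (x := p.1) (TyEq.refl hS p.2)) (by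
      simpa [names, Ctx.dom_singleton, Config.chans_zero] using h₁)
    rw [add_comm Δ, Multiset.singleton_add] at this
    simpa using this

theorem SeqTyped.cTyped (hS : S.WF) {Δ₀ Δ : Ctx Lab TN} {C : Config Lab TN ar}
    (h : SeqTyped S Δ₀ C Δ) : CTyped S Δ₀ C Δ := by
  -- The subforest feeding a node is a smaller configuration, but not a subderivation.
  obtain ⟨k, hk⟩ : ∃ k, C.card ≤ k := ⟨_, le_rfl⟩
  induction k generalizing Δ₀ C Δ with
  | zero =>
    induction h with
    | id hn => exact .id hS hn
    | conv _ he ih => exact (ih hk).conv hS he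
    | cons => simp at hk
  | succ k ihk =>
    induction h with
    | id hn => exact .id hS hn
    | conv _ he ih => exact (ih hk).conv hS he
    | @cons Ω Δ C n x A h hn hx _ =>
      obtain ⟨Γa, Γb, Ca, Cb, rfl, rfl, h₁, h₂, hd⟩ := h.split
      rw [Multiset.card_cons, Multiset.card_add] at hk
      rw [chansOf_add] at hx
      have hm := hn.mem_chans
      have hc := hn.chans_subset
      have hs := h₁.dom_subset
      have c₁ := ihk h₁ (by omega)
      have c₂ := ihk h₂ (by omega)
      have hx₁ : Disjoint (Ctx.dom ((x, A) ::ₘ 0)) (names Γa Ca Ω) := by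
        rw [names_eq_chansOf h₁, Set.disjoint_left]
        simp only [Ctx.mem_dom_cons, mem_chansOf, Set.mem_union] at *
        rintro c (rfl | hc) <;> [tauto; exact absurd hc Ctx.not_mem_dom_zero]
      have c₃ : CTyped S Γa (n ::ₘ Ca) {(x, A)} := by
        cases hn with
        | proc hP => simpa using CTyped.proc (Δ₀' := 0) c₁ (by simpa using hP) (by simp) hx₁
        | msg hM => simpa using CTyped.msg (Δ₀' := 0) c₁ (by simpa using hM) (by simp) hx₁
      have := CTyped.comp c₂ c₃ (by
        rw [names_eq_chansOf h₂, names_eq_chansOf (c₃.seqTyped hS)]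
        rw [Set.disjoint_left] at *
        simp only [mem_chansOf, mem_chans_cons, Set.mem_union] at *
        grind)
      rwa [add_comm Γb, Multiset.add_cons, add_comm Cb, ← Multiset.cons_add, Multiset.cons_add]
        at this

/-! ### The naming convention for generations -/

/-- Among the channels in `N`, only those in `L` have a later generation in `N`. -/
def GenLinked (N L : Set Chan) : Prop :=
  ∀ c ∈ N, ∀ c' ∈ N, c.base = c'.base → c.gen < c'.gen → c ∈ L

/-- The channels linked to their next generation by a message of `D`. -/
def linkedChans (D : Config Lab TN ar) : Set Chan :=
  {c | ∃ M : Msg Lab, Node.msg M ∈ D ∧ M.Links c}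

theorem Chan.next_ne (y : Chan) : y.next ≠ y := by
  intro h
  have := congrArg Chan.gen h
  simp [Chan.next] at this

theorem GenLinked.mono {N N' L L' : Set Chan} (h : GenLinked N L) (hN : ∀ c ∈ N', c ∈ N)
    (hL : ∀ c ∈ N', c ∈ L → c ∈ L') : GenLinked N' L' :=
  fun c hc c' hc' hb hg => hL c hc (h c (hN c hc) c' (hN c' hc') hb hg)

/-- If `y` is not linked, its next generation is unused. -/
theorem GenLinked.next_not_mem {N L : Set Chan} {y : Chan} (h : GenLinked N L) (hy : y ∈ N)
    (hyL : y ∉ L) : y.next ∉ N :=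
  fun hn => hyL (h y hy _ hn rfl (Nat.lt_succ_self _))

/-- Linking an unlinked `y` to its next generation keeps the naming convention. -/
theorem GenLinked.insert_next {N L : Set Chan} {y : Chan} (h : GenLinked N L) (hy : y ∈ N)
    (hyL : y ∉ L) : GenLinked (insert y.next N) (insert y L) := by
  have aux : ∀ {c : Chan}, c.base = y.base → c.gen = y.gen → c = y := by
    rintro ⟨b, g⟩ rfl rfl
    rfl
  rintro c (rfl | hc) c' (rfl | hc') hb hg
  · exact absurd hg (lt_irrefl _)
  · -- A generation of `y` later than `y.next` would require `y` to be linked already.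
    exact absurd (h y hy c' hc' hb (lt_trans (Nat.lt_succ_self _) hg)) hyL
  · rcases (Nat.lt_succ_iff.1 hg).lt_or_eq with hg | hg
    · exact .inr (h c hc y hy hb hg)
    · exact .inl (aux hb hg)
  · exact .inr (h c hc c' hc' hb hg)

theorem GenLinked.insert_fresh {N L : Set Chan} {x : Chan} (h : GenLinked N L)
    (hx : ∀ c ∈ N, c.base ≠ x.base) : GenLinked (insert x N) L := by
  rintro c (rfl | hc) c' (rfl | hc') hb hg
  · exact absurd hg (lt_irrefl _)
  · exact absurd hb.symm (hx c' hc')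
  · exact absurd hb (hx c hc)
  · exact h c hc c' hc' hb hg

theorem Msg.Links.carrier_eq {M : Msg Lab} {c : Chan} (h : M.Links c) : M.carrier = c := by
  rcases h with ⟨k, rfl⟩ | ⟨z, rfl⟩ <;> rfl

theorem Msg.carrier_mem (M : Msg Lab) : M.carrier ∈ M.chans := by
  cases M <;> simp [Msg.carrier, Msg.chans]

theorem Msg.Links.mem_chans {M : Msg Lab} {c : Chan} (h : M.Links c) : c ∈ M.chans :=
  h.carrier_eq ▸ M.carrier_mem

theorem linkedChans_cons_proc (y : Chan) (P : Proc Lab TN ar Chan) (D : Config Lab TN ar) :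
    linkedChans (.proc y P ::ₘ D) = linkedChans D := by
  ext c; simp [linkedChans]

theorem linkedChans_cons_msg (M : Msg Lab) (D : Config Lab TN ar) :
    linkedChans (.msg M ::ₘ D) = {c | M.Links c} ∪ linkedChans D := by
  ext c; simp [linkedChans]

theorem linkedChans_add (D D' : Config Lab TN ar) :
    linkedChans (D + D') = linkedChans D ∪ linkedChans D' := by
  ext c
  simp only [linkedChans, Multiset.mem_add, Set.mem_ofPred_eq, Set.mem_union]
  grind

theorem linkedChans_subset {D : Config Lab TN ar} {c : Chan} (h : c ∈ linkedChans D) :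
    c ∈ Config.chans D := by
  obtain ⟨M, hM, hc⟩ := h
  exact ⟨_, hM, hc.mem_chans⟩

theorem tree_iff (hS : S.WF) {Δ : Ctx Lab TN} {K : Chan × Ty Lab TN} {D : Config Lab TN ar} :
    Tree S Δ K D ↔ SeqTyped S Δ D {K} ∧ GenLinked (chansOf Δ D) (linkedChans D) := by
  constructor
  · rintro ⟨h₁, h₂⟩
    have h := h₁.seqTyped hS
    refine ⟨h, ?_⟩
    rw [← names_eq_chansOf h]
    exact h₂
  · rintro ⟨h₁, h₂⟩
    rw [← names_eq_chansOf h₁] at h₂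
    exact ⟨h₁.cTyped hS, h₂⟩

/-! ### Substitution of channels in process terms -/

theorem map_advance {Ω : Ctx Lab TN} {y : Chan} (hy : y ∉ Ctx.dom Ω) :
    Ω.map (Prod.map (advance y) id) = Ω := by
  conv_rhs => rw [← Multiset.map_id Ω]
  refine Multiset.map_congr rfl fun p hp => ?_
  have : p.1 ≠ y := by
    rintro rfl
    exact hy ⟨p.2, hp⟩
  simp [advance, this, Prod.map]

theorem map_lift_inst {Ω : Ctx Lab TN} {z : Chan} {f : Chan → Chan} :
    (lift Ω).map (Prod.map (fun o => inst z (o.map f)) id) = Ω.map (Prod.map f id) := by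
  simp [lift, Prod.map, inst]

theorem PTyped.advance_right {Ω : Ctx Lab TN} {P : Proc Lab TN ar Chan} {y : Chan}
    {A : Ty Lab TN} (h : PTyped S Ω P y A) (hy : y ∉ Ctx.dom Ω) :
    PTyped S Ω (P.map (advance y)) y.next A := by
  have := h.map (advance y)
  rwa [map_advance hy, show advance y y = y.next from if_pos rfl] at this

theorem PTyped.advance_left {Ω : Ctx Lab TN} {P : Proc Lab TN ar Chan} {x y : Chan}
    {A T : Ty Lab TN} (h : PTyped S ((y, T) ::ₘ Ω) P x A) (hy : y ∉ Ctx.dom Ω) (hxy : x ≠ y) :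
    PTyped S ((y.next, T) ::ₘ Ω) (P.map (advance y)) x A := by
  have := h.map (advance y)
  rw [Multiset.map_cons, map_advance hy, show advance y x = x from if_neg hxy] at this
  simpa [advance] using this

theorem PTyped.inst_advance_right {Ω : Ctx Lab TN} {P : Proc Lab TN ar (Option Chan)}
    {y : Chan} {A B : Ty Lab TN} (h : PTyped S ((none, A) ::ₘ lift Ω) P (some y) B)
    (hy : y ∉ Ctx.dom Ω) (z : Chan) :
    PTyped S ((z, A) ::ₘ Ω) (P.map (fun o => inst z (o.map (advance y)))) y.next B := by
  have := h.map (fun o => inst z (o.map (advance y)))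
  rw [Multiset.map_cons, map_lift_inst, map_advance hy] at this
  simpa [advance, inst] using this

theorem PTyped.inst_advance_left {Ω : Ctx Lab TN} {P : Proc Lab TN ar (Option Chan)}
    {x y : Chan} {A B C : Ty Lab TN}
    (h : PTyped S ((none, A) ::ₘ (some y, B) ::ₘ lift Ω) P (some x) C)
    (hy : y ∉ Ctx.dom Ω) (hxy : x ≠ y) (z : Chan) :
    PTyped S ((z, A) ::ₘ (y.next, B) ::ₘ Ω)
      (P.map (fun o => inst z (o.map (advance y)))) x C := by
  have := h.map (fun o => inst z (o.map (advance y)))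
  rw [Multiset.map_cons, Multiset.map_cons, map_lift_inst, map_advance hy] at this
  simpa [advance, inst, hxy] using this

theorem PTyped.inst {Ω : Ctx Lab TN} {P : Proc Lab TN ar (Option Chan)} {x : Chan}
    {A C : Ty Lab TN} (h : PTyped S ((none, A) ::ₘ lift Ω) P (some x) C) (z : Chan) :
    PTyped S ((z, A) ::ₘ Ω) (P.map (RSLR.inst z)) x C := by
  have := h.map (RSLR.inst z)
  simpa [RSLR.inst, lift, Prod.map, Function.comp_def] using this

/-! ### Polarity of senders and messages -/

/-- The process term sends along `y`, other than by closing it. -/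
def Proc.Sends (P : Proc Lab TN ar Chan) (y : Chan) : Prop :=
  (∃ k Q, P = .sel y k Q) ∨ ∃ z Q, P = .send z y Q

theorem Sig.pos_plus {L : Finset Lab} {A : Lab → Ty Lab TN} : S.Pos (.plus L A) :=
  .inr (.inl ⟨L, A, rfl⟩)

theorem Sig.pos_tensor {A B : Ty Lab TN} : S.Pos (.tensor A B) := .inr (.inr ⟨A, B, rfl⟩)

theorem Sig.neg_amp {L : Finset Lab} {A : Lab → Ty Lab TN} : S.Neg (.amp L A) := .inl ⟨L, A, rfl⟩

theorem Sig.neg_lolli {A B : Ty Lab TN} : S.Neg (.lolli A B) := .inr ⟨A, B, rfl⟩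

theorem PTyped.pos_of_sends (hS : S.WF) {Ω : Ctx Lab TN} {P : Proc Lab TN ar Chan} {y : Chan}
    {A : Ty Lab TN} (h : PTyped S Ω P y A) (hP : P.Sends y) (hy : y ∉ Ctx.dom Ω) : S.Pos A := by
  obtain ⟨Ω', A', he, hA, h'⟩ := h.exists_headTyped hS
  rw [he.dom] at hy
  rcases hP with ⟨k, Q, rfl⟩ | ⟨z, Q, rfl⟩
  · rcases h' with ⟨-, L, B, rfl, -⟩ | ⟨Ω'', L, B, rfl, -⟩
    · exact hA.symm.pos Sig.pos_plus
    · simp [Ctx.mem_dom_cons] at hy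
  · rcases h' with ⟨-, Ω'', B, C, rfl, rfl, -⟩ | ⟨Ω'', B, C, rfl, -⟩
    · exact hA.symm.pos Sig.pos_tensor
    · simp [Ctx.mem_dom_cons] at hy

theorem PTyped.neg_of_sends (hS : S.WF) {Ω : Ctx Lab TN} {P : Proc Lab TN ar Chan} {x y : Chan}
    {A T : Ty Lab TN} (h : PTyped S ((y, T) ::ₘ Ω) P x A) (hP : P.Sends y) (hxy : y ≠ x)
    (hy : y ∉ Ctx.dom Ω) : S.Neg T := by
  obtain ⟨Ω', A', he, hA, h'⟩ := h.exists_headTyped hS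
  -- By linearity, the type of `y` is determined by the context.
  have key : ∀ {U Θ}, Ω' = (y, U) ::ₘ Θ → TyEq S T U := by
    rintro U Θ rfl
    obtain ⟨T', Θ', h₁, h₂, h₃⟩ := he.cons_right
    rcases Multiset.cons_eq_cons.1 h₁ with ⟨h₁, -⟩ | ⟨-, Θ'', rfl, -⟩
    · cases h₁
      exact h₂
    · simp [Ctx.mem_dom_cons] at hy
  rcases hP with ⟨k, Q, rfl⟩ | ⟨z, Q, rfl⟩
  · rcases h' with ⟨rfl, -⟩ | ⟨Ω'', L, B, h', -⟩
    · exact absurd rfl hxy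
    · exact (key h').neg Sig.neg_amp
  · rcases h' with ⟨rfl, -⟩ | ⟨Ω'', B, C, h', -⟩
    · exact absurd rfl hxy
    · exact (key (h'.trans (Multiset.cons_swap _ _ _))).neg Sig.neg_lolli

theorem MTyped.pos_of_links {Ω : Ctx Lab TN} {M : Msg Lab} {y : Chan} {A : Ty Lab TN}
    (h : MTyped S Ω M y A) (hM : M.Links y) : S.Pos A := by
  have hc := hM.carrier_eq
  cases h with
  | plusR hT => exact hT.pos Sig.pos_plus
  | ampL => exact absurd hc.symm (Chan.next_ne _)
  | tensorR hT => exact hT.pos Sig.pos_tensor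
  | lolliL => exact absurd hc.symm (Chan.next_ne _)
  | oneR => rcases hM with ⟨k, h⟩ | ⟨z, h⟩ <;> cases h

theorem MTyped.lab_inv {Ω : Ctx Lab TN} {y x : Chan} {k : Lab} {A : Ty Lab TN}
    (h : MTyped S Ω (.lab y k) x A) (hx : x = y) :
    ∃ L B U, Ω = {(y.next, U)} ∧ k ∈ L ∧ TyEq S A (.plus L B) ∧ TyEq S U (B k) := by
  cases h with
  | plusR hT hU hk => exact ⟨_, _, _, rfl, hk, hT, hU⟩
  | ampL => exact absurd hx (Chan.next_ne _)

theorem MTyped.send_inv {Ω : Ctx Lab TN} {y x z : Chan} {A : Ty Lab TN}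
    (h : MTyped S Ω (.send z y) x A) (hx : x = y) :
    ∃ B C, Ω = {(z, B), (y.next, C)} ∧ TyEq S A (.tensor B C) := by
  cases h with
  | tensorR hT => exact ⟨_, _, rfl, hT⟩
  | lolliL => exact absurd hx (Chan.next_ne _)

theorem MTyped.close_inv {Ω : Ctx Lab TN} {y x : Chan} {A : Ty Lab TN}
    (h : MTyped S Ω (.close y) x A) : Ω = 0 ∧ x = y ∧ TyEq S A .one := by
  cases h with
  | oneR hT => exact ⟨rfl, rfl, hT⟩

/-- A message using its carrier is one of the two messages of negative type, and provides the next
generation of the carrier. -/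
theorem MTyped.carrier_left {Ω : Ctx Lab TN} {M : Msg Lab} {x y : Chan} {A T : Ty Lab TN}
    (h : MTyped S ((y, T) ::ₘ Ω) M x A) (hM : M.carrier = y) (hy : y ∉ Ctx.dom Ω)
    (hxy : y ≠ x) : x = y.next ∧
      ((∃ k L B, M = .lab y k ∧ Ω = 0 ∧ k ∈ L ∧ TyEq S T (.amp L B) ∧ TyEq S A (B k)) ∨
        ∃ z B, M = .send z y ∧ Ω = {(z, B)} ∧ TyEq S T (.lolli B A)) := by
  generalize hΩ : (y, T) ::ₘ Ω = Ω' at h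
  cases h with
  | plusR hT => exact absurd hM.symm hxy
  | tensorR hT => exact absurd hM.symm hxy
  | oneR => exact absurd hM.symm hxy
  | @ampL y' L B k T' _ hT hU hk =>
    obtain ⟨h₁, rfl⟩ := (Multiset.singleton_eq_cons_iff _).1 hΩ.symm
    cases h₁
    exact ⟨rfl, .inl ⟨_, _, _, rfl, rfl, hk, hT, hU⟩⟩
  | @lolliL y' z T' B _ hT =>
    obtain rfl : y' = y := hM
    rcases Multiset.cons_eq_cons.1 hΩ with ⟨h₁, rfl⟩ | ⟨-, Θ, rfl, h₂⟩
    · simp [Ctx.mem_dom_singleton] at hy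
    · rcases (Multiset.singleton_eq_cons_iff _).1 h₂ with ⟨h₃, rfl⟩
      cases h₃
      exact ⟨rfl, .inr ⟨_, _, rfl, rfl, hT⟩⟩

theorem MTyped.neg_of_links {Ω : Ctx Lab TN} {M : Msg Lab} {x y : Chan} {A T : Ty Lab TN}
    (h : MTyped S ((y, T) ::ₘ Ω) M x A) (hM : M.Links y) (hy : y ∉ Ctx.dom Ω)
    (hxy : y ≠ x) : S.Neg T := by
  rcases (h.carrier_left hM.carrier_eq hy hxy).2 with
    ⟨k, L, B, -, -, -, hT, -⟩ | ⟨z, B, -, -, hT⟩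
  · exact hT.neg Sig.neg_amp
  · exact hT.neg Sig.neg_lolli

theorem Proc.Sends.mem_fn {P : Proc Lab TN ar Chan} {y : Chan} (h : P.Sends y) : y ∈ P.fn := by
  rcases h with ⟨k, Q, rfl⟩ | ⟨z, Q, rfl⟩ <;> simp [Proc.fn]

/-- A channel on which a process is about to send is not linked to its next generation: otherwise
the provider and the user of the channel would disagree on its polarity. -/
theorem SeqTyped.not_linked_of_sends (hS : S.WF) {Δ₀ Δ : Ctx Lab TN} {C : Config Lab TN ar}
    {x y : Chan} {P : Proc Lab TN ar Chan} (h : SeqTyped S Δ₀ (.proc x P ::ₘ C) Δ)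
    (hP : P.Sends y) : y ∉ linkedChans (.proc x P ::ₘ C) := by
  rw [linkedChans_cons_proc]
  rintro ⟨M, hM, hMy⟩
  obtain ⟨C, rfl⟩ := Multiset.exists_cons_of_mem hM
  rcases h.linked hS (.inr hP.mem_fn) hMy.mem_chans with
    ⟨-, h₁, ha, hA, hb, hy, -, hyx, -, -, -⟩ | ⟨-, h₁, ha, hA, hb, hy, -, hyx, -, -, -⟩
  all_goals
    have hs := h₁.dom_subset
    simp only [Ctx.mem_dom_add] at hs
    have hya := fun hc => hy (hs y (.inl hc))
    have hyb := fun hc => hy (hs y (.inr (.inl hc)))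
  · cases ha with
    | proc ha =>
      cases hb with
      | msg hb =>
        exact (hA.symm.pos (ha.pos_of_sends hS hP hya)).not_neg (hb.neg_of_links hMy hyb hyx)
  · cases ha with
    | msg ha =>
      cases hb with
      | proc hb =>
        exact (hA.symm.pos (ha.pos_of_links hMy)).not_neg (hb.neg_of_sends hS hP hyx hyb)

theorem Proc.Waits.mem_fn {P : Proc Lab TN ar Chan} {y : Chan} (h : P.Waits y) : y ∈ P.fn := by
  rcases h with ⟨Q, rfl⟩ | ⟨L, Q, rfl⟩ | ⟨Q, rfl⟩ <;> simp [Proc.fn]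

/-- An interface channel on which a process is about to receive is not linked to its next
generation, because it occurs in one node only. -/
theorem SeqTyped.not_linked_of_waits (hS : S.WF) {Δ : Ctx Lab TN} {K : Chan × Ty Lab TN}
    {D : Config Lab TN ar} {y : Chan} (h : SeqTyped S Δ D {K}) (hy : y ∈ recvReady Δ K D) :
    y ∉ linkedChans D := by
  obtain ⟨hi, u, P, hP, hw⟩ := hy
  rintro ⟨M, hM, hMy⟩
  obtain ⟨C, rfl⟩ := Multiset.exists_cons_of_mem hP
  obtain ⟨C, rfl⟩ := Multiset.exists_cons_of_mem ((Multiset.mem_cons.1 hM).resolve_left (by simp))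
  have hn : y ∉ Ctx.dom Δ ∧ y ∉ Ctx.dom {K} := by
    rcases h.linked hS (.inr hw.mem_fn) hMy.mem_chans with h | h <;> exact h.not_mem
  rcases Ctx.mem_dom_cons.1 hi with rfl | hi
  · exact hn.2 (Ctx.mem_dom_singleton.2 rfl)
  · exact hn.1 hi

/-! ### Preservation -/

/-- A process is replaced by a message linking `y` and a continuation, one of which provides
`y.next` to the other. -/
theorem preserve_send (hS : S.WF) {Δ₀ Δ : Ctx Lab TN} {C : Config Lab TN ar}
    {y u u' : Chan} {P P' : Proc Lab TN ar Chan} {M : Msg Lab} {n₁ n₂ : Node Lab TN ar}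
    (h : SeqTyped S Δ₀ (.proc u P ::ₘ C) Δ)
    (hg : GenLinked (chansOf Δ₀ (.proc u P ::ₘ C)) (linkedChans (.proc u P ::ₘ C)))
    (hP : P.Sends y) (hM : M.Links y)
    (hnn : n₂ ::ₘ n₁ ::ₘ C = .proc u' P' ::ₘ .msg M ::ₘ C)
    (hn : ∀ Ω x A, Ctx.Linear ((x, A) ::ₘ Ω) → NTyped S Ω (.proc u P) x A →
      ∃ Ω₁ Ω₂ U, CtxEq S Ω (Ω₁ + Ω₂) ∧ NTyped S Ω₁ n₁ y.next U ∧
        NTyped S ((y.next, U) ::ₘ Ω₂) n₂ x A) :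
    SeqTyped S Δ₀ (.proc u' P' ::ₘ .msg M ::ₘ C) Δ ∧
      GenLinked (chansOf Δ₀ (.proc u' P' ::ₘ .msg M ::ₘ C))
        (linkedChans (.proc u' P' ::ₘ .msg M ::ₘ C)) := by
  have hl := h.not_linked_of_sends hS hP
  have hy : y ∈ chansOf Δ₀ (.proc u P ::ₘ C) :=
    .inr (mem_chans_cons.2 (.inl (.inr hP.mem_fn)))
  obtain ⟨h₁, h₂⟩ := h.replace_two hS (hg.next_not_mem hy hl) hn
  rw [hnn] at h₁ h₂
  refine ⟨h₁, (hg.insert_next hy hl).mono h₂ fun c _ hc => ?_⟩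
  rw [linkedChans_cons_proc] at hc
  rw [linkedChans_cons_proc, linkedChans_cons_msg]
  rcases hc with rfl | hc
  · exact .inl hM
  · exact .inr hc

/-- A message with carrier `y` and a process are replaced by a process in which `y` no longer
occurs. -/
theorem preserve_recv {Δ₀ Δ : Ctx Lab TN} {C : Config Lab TN ar}
    {y u u' : Chan} {P P' : Proc Lab TN ar Chan} {M : Msg Lab} {a b : Node Lab TN ar}
    (hM : M.carrier = y)
    (hab : a ::ₘ b ::ₘ C = .msg M ::ₘ .proc u P ::ₘ C)
    (hg : GenLinked (chansOf Δ₀ (.msg M ::ₘ .proc u P ::ₘ C))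
      (linkedChans (.msg M ::ₘ .proc u P ::ₘ C)))
    (h : SeqTyped S Δ₀ (.proc u' P' ::ₘ C) Δ ∧ y ∉ chansOf Δ₀ (.proc u' P' ::ₘ C) ∧
      ∀ c ∈ chansOf Δ₀ (.proc u' P' ::ₘ C), c ∈ chansOf Δ₀ (a ::ₘ b ::ₘ C)) :
    SeqTyped S Δ₀ (.proc u' P' ::ₘ C) Δ ∧
      GenLinked (chansOf Δ₀ (.proc u' P' ::ₘ C)) (linkedChans (.proc u' P' ::ₘ C)) := by
  obtain ⟨h₁, h₂, h₃⟩ := h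
  rw [hab] at h₃
  refine ⟨h₁, hg.mono h₃ fun c hc hc' => ?_⟩
  rw [linkedChans_cons_msg, linkedChans_cons_proc] at hc'
  rw [linkedChans_cons_proc]
  rcases hc' with hc' | hc'
  · have := hc'.carrier_eq.symm.trans hM
    exact absurd (this ▸ hc) h₂
  · exact hc'

/-- Well-typedness and the naming convention are preserved by reduction. -/
theorem Step.preserve (hS : S.WF) {N : Set Chan} {Δ₀ Δ : Ctx Lab TN} {D D' : Config Lab TN ar}
    (hN : Ctx.dom Δ₀ ⊆ N) (hs : Step S N D D') (h : SeqTyped S Δ₀ D Δ)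
    (hg : GenLinked (chansOf Δ₀ D) (linkedChans D)) :
    SeqTyped S Δ₀ D' Δ ∧ GenLinked (chansOf Δ₀ D') (linkedChans D') := by
  cases hs with
  | @spawn C y X γ Q b hb =>
    have hb' : ∀ c ∈ chansOf Δ₀ (.proc y (.spawn X γ Q) ::ₘ C), c.base ≠ b := by
      rintro c (hc | hc)
      · exact hb c (.inl (hN hc))
      · exact hb c (.inr hc)
    obtain ⟨h₁, h₂⟩ := h.replace_two (z := ⟨b, 0⟩)
      (n₁ := .proc ⟨b, 0⟩ ((S.body X).map (fun o => o.elim ⟨b, 0⟩ γ)))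
      (n₂ := .proc y (Q.map (inst ⟨b, 0⟩))) hS (fun hc => hb' _ hc rfl) (by
        rintro Ω x A hl ⟨hP⟩
        obtain ⟨Ω', A', he, hA, Ω'', rfl, hQ⟩ := hP.exists_headTyped hS
        refine ⟨_, Ω'', _, he, .proc ?_, .proc (.tvarR hA (hQ.inst _))⟩
        have := (hS.typed X).map (fun o : Option (Fin (ar X)) => o.elim (⟨b, 0⟩ : Chan) γ)
        rw [Multiset.map_map] at this
        exact this)
    rw [Multiset.cons_swap] at h₁ h₂
    refine ⟨h₁, (hg.insert_fresh (x := ⟨b, 0⟩) hb').mono h₂ fun c _ hc => ?_⟩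
    rw [linkedChans_cons_proc] at hc
    rwa [linkedChans_cons_proc, linkedChans_cons_proc]
  | @dfwd C y x Y =>
    obtain ⟨h₁, h₂⟩ := h.replace (n' := .proc y (fwder ar (S.tyDef Y) y x)) (by
      rintro Ω x A hl ⟨hP⟩
      obtain ⟨Ω', A', he, hA, -, rfl, rfl⟩ := hP.exists_headTyped hS
      have hY : TyEq S (.var Y) (S.tyDef Y) := TyEq.unfold hS (.var Y)
      exact .proc (.tvarR (hY.symm.trans hA) ((ptyped_fwder _ _ _).ctxEq
        (CtxEq.trans he (.cons hY .zero)).symm)))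
    refine ⟨h₁, hg.mono h₂ fun c _ hc => ?_⟩
    rwa [linkedChans_cons_proc] at hc ⊢
  | @oneSnd C y =>
    obtain ⟨h₁, h₂⟩ := h.replace (n' := .msg (.close y)) (by
      rintro Ω x A hl ⟨hP⟩
      obtain ⟨Ω', A', he, hA, -, rfl, rfl⟩ := hP.exists_headTyped hS
      rw [he.zero_right]
      exact .msg (.oneR hA.symm))
    refine ⟨h₁, hg.mono h₂ fun c _ hc => ?_⟩
    rw [linkedChans_cons_proc] at hc
    rw [linkedChans_cons_msg]
    exact .inr hc
  | @plusSnd C y k P =>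
    refine preserve_send hS (n₁ := .proc y.next (P.map (advance y))) (n₂ := .msg (.lab y k))
      h hg (.inl ⟨k, P, rfl⟩) (.inl ⟨k, rfl⟩) (Multiset.cons_swap _ _ _) ?_
    rintro Ω x A hl ⟨hP⟩
    obtain ⟨Ω', A', he, hA, h'⟩ := hP.exists_headTyped hS
    have hy := (Ctx.linear_cons.1 hl).1
    rw [he.dom] at hy
    rcases h' with ⟨-, L, B, rfl, hk, hP⟩ | ⟨Ω'', L, B, rfl, -⟩
    · exact ⟨Ω', 0, B k, by simpa using he, .proc (hP.advance_right hy),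
        .msg (.plusR hA.symm (.refl hS _) hk)⟩
    · simp [Ctx.mem_dom_cons] at hy
  | @ampSnd C y x k P hyx =>
    rw [Multiset.cons_swap]
    refine preserve_send hS (n₁ := .msg (.lab x k)) (n₂ := .proc y (P.map (advance x)))
      h hg (.inl ⟨k, P, rfl⟩) (.inl ⟨k, rfl⟩) rfl ?_
    rintro Ω _ A hl ⟨hP⟩
    obtain ⟨Ω', A', he, hA, h'⟩ := hP.exists_headTyped hS
    rcases h' with ⟨rfl, -⟩ | ⟨Ω'', L, B, rfl, hk, hP⟩
    · exact absurd rfl hyx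
    · have hx := (Ctx.linear_cons.1 (he.linear (Ctx.linear_cons.1 hl).2)).1
      exact ⟨{(x, .amp L B)}, Ω'', B k, by rwa [Multiset.singleton_add],
        .msg (.ampL (.refl hS _) (.refl hS _) hk), .proc (.tvarR hA (hP.advance_left hx hyx))⟩
  | @tensorSnd C y z P =>
    refine preserve_send hS (n₁ := .proc y.next (P.map (advance y))) (n₂ := .msg (.send z y))
      h hg (.inr ⟨z, P, rfl⟩) (.inr ⟨z, rfl⟩) (Multiset.cons_swap _ _ _) ?_
    rintro Ω x A hl ⟨hP⟩
    obtain ⟨Ω', A', he, hA, h'⟩ := hP.exists_headTyped hS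
    have hy := (Ctx.linear_cons.1 hl).1
    rw [he.dom] at hy
    rcases h' with ⟨-, Ω'', B, B', rfl, rfl, hP⟩ | ⟨Ω'', B, B', rfl, -⟩
    · refine ⟨Ω'', {(z, B)}, B', by rwa [add_comm, Multiset.singleton_add],
        .proc (hP.advance_right fun hc => hy (Ctx.mem_dom_cons.2 (.inr hc))), .msg ?_⟩
      rw [← Multiset.insert_eq_cons, Multiset.pair_comm]
      exact .tensorR hA.symm
    · simp [Ctx.mem_dom_cons] at hy
  | @lolliSnd C y z x P hyx =>
    rw [Multiset.cons_swap]
    refine preserve_send hS (n₁ := .msg (.send z x)) (n₂ := .proc y (P.map (advance x)))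
      h hg (.inr ⟨z, P, rfl⟩) (.inr ⟨z, rfl⟩) rfl ?_
    rintro Ω _ A hl ⟨hP⟩
    obtain ⟨Ω', A', he, hA, h'⟩ := hP.exists_headTyped hS
    rcases h' with ⟨rfl, -⟩ | ⟨Ω'', B, B', rfl, hP⟩
    · exact absurd rfl hyx
    · have hx := (Ctx.linear_cons.1 (Ctx.linear_cons.1
        (he.linear (Ctx.linear_cons.1 hl).2)).2).1
      exact ⟨{(z, B), (x, .lolli B B')}, Ω'', B',
        by simpa [Multiset.insert_eq_cons, Multiset.cons_add] using he,
        .msg (.lolliL (.refl hS _)), .proc (.tvarR hA (hP.advance_left hx hyx))⟩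
  | @oneRcv C y x Q hxy =>
    refine preserve_recv rfl rfl hg ?_
    rcases h.linked hS (y := y) (by simp [Node.chans, Msg.chans])
      (by simp [Node.chans, Proc.fn]) with hl | hl
    · refine hl.replace ?_
      rintro Ωa Ωb A A' _ B - - hyb - - - (_ | ha) hA ⟨hP⟩
      obtain ⟨Ω', B', he, hB, Ω'', rfl, hQ⟩ := hP.exists_headTyped hS
      have he := (he.cons_cancel hyb).2
      cases ha
      rw [zero_add]
      exact .proc (.tvarR hB (hQ.ctxEq he.symm))
    · exact absurd hl.left_proc hxy
  | @plusRcv C y u k L P huy hk =>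
    refine preserve_recv rfl rfl hg ?_
    rcases h.linked hS (y := y) (by simp [Node.chans, Msg.chans])
      (by simp [Node.chans, Proc.fn]) with hl | hl
    · refine hl.replace ?_
      rintro Ωa Ωb A A' _ B - - hyb - - - (_ | ha) hA ⟨hP⟩
      obtain ⟨L', T, U, rfl, -, hT, hU⟩ := ha.lab_inv rfl
      obtain ⟨Ω', B', he, hB, ⟨rfl, -⟩ | ⟨Ω'', T', rfl, hQ⟩⟩ := hP.exists_headTyped hS
      · exact absurd rfl huy
      · obtain ⟨hA', he⟩ := he.cons_cancel hyb
        obtain ⟨rfl, hTT⟩ := TyEq.plus_inj (hA.trans hA') hT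
        have hQ := (hQ k hk).advance_left (he.dom ▸ hyb) huy
        rw [Multiset.singleton_add]
        exact .proc (.tvarR hB (hQ.ctxEq
          (CtxEq.cons ((hTT k hk).trans hU.symm) he.symm)))
    · exact absurd hl.left_proc huy
  | @ampRcv C y k L P hk =>
    refine preserve_recv (y := y) rfl (Multiset.cons_swap _ _ _)
      (by rwa [Multiset.cons_swap]) ?_
    rcases h.linked hS (y := y) (by simp [Node.chans])
      (by simp [Node.chans, Msg.chans]) with hl | hl
    · refine hl.replace ?_
      rintro Ωa Ωb A A' x B - hya hyb hyx - - ⟨hP⟩ hA (_ | hb)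
      obtain ⟨rfl, ⟨k', L', T, h₁, rfl, -, hT, hB⟩ | ⟨z, B', h₁, -⟩⟩ :=
        hb.carrier_left rfl hyb hyx
      · cases h₁
        obtain ⟨Ω', B', he, hB', h'⟩ := hP.exists_headTyped hS
        rw [he.dom] at hya
        rcases h' with ⟨-, T', rfl, hQ⟩ | ⟨Ω'', T', rfl, -⟩
        · obtain ⟨rfl, hTT⟩ := TyEq.amp_inj (hB'.trans (hA.trans hT)) (.refl hS _)
          rw [add_zero]
          have h₃ := (TyEq.amp_inj (hB'.trans (hA.trans hT)) (.refl hS _)).2 k hk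
          exact .proc (.tvarR (h₃.symm.trans hB.symm)
            (((hQ k hk).advance_right hya).ctxEq he.symm))
        · simp [Ctx.mem_dom_cons] at hya
      · cases h₁
    · exact absurd rfl hl.right_proc
  | @tensorRcv C y z u P huy =>
    refine preserve_recv rfl rfl hg ?_
    rcases h.linked hS (y := y) (by simp [Node.chans, Msg.chans])
      (by simp [Node.chans, Proc.fn]) with hl | hl
    · refine hl.replace ?_
      rintro Ωa Ωb A A' _ B - - hyb - - - (_ | ha) hA ⟨hP⟩
      obtain ⟨T, U, rfl, hT⟩ := ha.send_inv rfl
      obtain ⟨Ω', B', he, hB, ⟨rfl, -⟩ | ⟨Ω'', T', U', rfl, hQ⟩⟩ := hP.exists_headTyped hS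
      · exact absurd rfl huy
      · obtain ⟨hA', he⟩ := he.cons_cancel hyb
        obtain ⟨h₁, h₂⟩ := TyEq.tensor_inj (hA.trans hA') hT
        have hQ := hQ.inst_advance_left (he.dom ▸ hyb) huy z
        rw [Multiset.insert_eq_cons, Multiset.cons_add, Multiset.singleton_add]
        exact .proc (.tvarR hB (hQ.ctxEq (CtxEq.cons h₁ (CtxEq.cons h₂ he.symm))))
    · exact absurd hl.left_proc huy
  | @lolliRcv C y z P =>
    refine preserve_recv (y := y) rfl (Multiset.cons_swap _ _ _)
      (by rwa [Multiset.cons_swap]) ?_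
    rcases h.linked hS (y := y) (by simp [Node.chans])
      (by simp [Node.chans, Msg.chans]) with hl | hl
    · refine hl.replace ?_
      rintro Ωa Ωb A A' x B - hya hyb hyx - - ⟨hP⟩ hA (_ | hb)
      obtain ⟨rfl, ⟨k', L', T, h₁, -⟩ | ⟨z', T, h₁, rfl, hT⟩⟩ := hb.carrier_left rfl hyb hyx
      · cases h₁
      · cases h₁
        obtain ⟨Ω', B', he, hB', h'⟩ := hP.exists_headTyped hS
        rw [he.dom] at hya
        rcases h' with ⟨-, T', U', rfl, hQ⟩ | ⟨Ω'', T', U', rfl, -⟩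
        · obtain ⟨h₁, h₂⟩ := TyEq.lolli_inj (.refl hS _) (hB'.trans (hA.trans hT))
          rw [add_comm, Multiset.singleton_add]
          exact .proc (.tvarR h₂ ((hQ.inst_advance_right hya z).ctxEq (CtxEq.cons h₁ he.symm)))
        · simp [Ctx.mem_dom_cons] at hya
    · exact absurd rfl hl.right_proc

/-! ### Renaming of channels -/

theorem Ctx.mem_dom_map {Δ : Ctx Lab TN} {f : Chan → Chan} {c : Chan} :
    c ∈ Ctx.dom (Δ.map (Prod.map f id)) ↔ ∃ d ∈ Ctx.dom Δ, f d = c := by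
  simp [Ctx.mem_dom]

theorem Node.chans_map {f : Chan → Chan} (hf : ∀ c, f c.next = (f c).next)
    (n : Node Lab TN ar) : (n.map f).chans = f '' n.chans := by
  cases n with
  | proc y P => simp [Node.map, Node.chans, Proc.fn_map, Set.image_insert_eq]
  | msg M =>
    cases M <;> simp [Node.map, Node.chans, Msg.map, Msg.chans, Set.image_insert_eq, hf]

theorem chansOf_map {f : Chan → Chan} (hf : ∀ c, f c.next = (f c).next) (Δ : Ctx Lab TN)
    (C : Config Lab TN ar) :
    chansOf (Δ.map (Prod.map f id)) (C.map (Node.map f)) = f '' chansOf Δ C := by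
  ext c
  simp only [mem_chansOf, Ctx.mem_dom_map, Config.chans, Multiset.mem_map, Set.mem_image,
    Set.mem_ofPred_eq]
  constructor
  · rintro (⟨d, hd, rfl⟩ | ⟨_, ⟨n, hn, rfl⟩, hc⟩)
    · exact ⟨d, .inl hd, rfl⟩
    · rw [Node.chans_map hf] at hc
      obtain ⟨d, hd, rfl⟩ := hc
      exact ⟨d, .inr ⟨n, hn, hd⟩, rfl⟩
  · rintro ⟨d, hd | ⟨n, hn, hd⟩, rfl⟩
    · exact .inl ⟨d, hd, rfl⟩
    · refine .inr ⟨_, ⟨n, hn, rfl⟩, ?_⟩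
      rw [Node.chans_map hf]
      exact ⟨d, hd, rfl⟩

theorem MTyped.map {f : Chan → Chan} (hf : ∀ c, f c.next = (f c).next) {Ω : Ctx Lab TN}
    {M : Msg Lab} {x : Chan} {A : Ty Lab TN} (h : MTyped S Ω M x A) :
    MTyped S (Ω.map (Prod.map f id)) (M.map f) (f x) A := by
  cases h <;>
    simp only [Multiset.insert_eq_cons, Multiset.map_cons, Multiset.map_singleton,
      Multiset.map_zero, Prod.map, hf, id, Msg.map]
  · exact .plusR (by assumption) (by assumption) (by assumption)
  · exact .ampL (by assumption) (by assumption) (by assumption)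
  · exact .tensorR (by assumption)
  · exact .lolliL (by assumption)
  · exact .oneR (by assumption)

theorem NTyped.map {f : Chan → Chan} (hf : ∀ c, f c.next = (f c).next) {Ω : Ctx Lab TN}
    {n : Node Lab TN ar} {x : Chan} {A : Ty Lab TN} (h : NTyped S Ω n x A) :
    NTyped S (Ω.map (Prod.map f id)) (n.map f) (f x) A := by
  cases h with
  | proc h => exact .proc (h.map f)
  | msg h => exact .msg (h.map hf)

theorem CtxEq.map {V W : Type} (f : V → W) {Ω Ω' : Multiset (V × Ty Lab TN)}
    (h : CtxEq S Ω Ω') : CtxEq S (Ω.map (Prod.map f id)) (Ω'.map (Prod.map f id)) :=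
  Multiset.rel_map.2 (h.mono fun _ _ _ _ h => ⟨congrArg f h.1, h.2⟩)

theorem SeqTyped.map {f : Chan → Chan} (hf : ∀ c, f c.next = (f c).next)
    (hi : Function.Injective f) {Δ₀ Δ : Ctx Lab TN} {C : Config Lab TN ar}
    (h : SeqTyped S Δ₀ C Δ) :
    SeqTyped S (Δ₀.map (Prod.map f _root_.id)) (C.map (Node.map f)) (Δ.map (Prod.map f _root_.id)) := by
  induction h with
  | id hn =>
    refine .id ?_
    rw [Ctx.Linear, Multiset.map_map]
    have := Multiset.Nodup.map hi hn
    rwa [Multiset.map_map] at this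
  | conv _ he ih => exact .conv ih (he.map f)
  | cons _ hn hx ih =>
    rw [Multiset.map_cons, Multiset.map_cons]
    rw [Multiset.map_add] at ih
    refine .cons ih (hn.map hf) ?_
    rw [chansOf_map hf]
    rintro ⟨d, hd, h⟩
    exact hx (hi h ▸ hd)

theorem linkedChans_map {f : Chan → Chan} {D : Config Lab TN ar} {c : Chan}
    (h : c ∈ linkedChans D) : f c ∈ linkedChans (D.map (Node.map f)) := by
  obtain ⟨M, hM, hc⟩ := h
  refine ⟨M.map f, Multiset.mem_map.2 ⟨_, hM, rfl⟩, ?_⟩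
  rcases hc with ⟨k, rfl⟩ | ⟨z, rfl⟩
  · exact .inl ⟨k, rfl⟩
  · exact .inr ⟨f z, rfl⟩

theorem map_fixed {Δ : Ctx Lab TN} {f : Chan → Chan} (h : ∀ c ∈ Ctx.dom Δ, f c = c) :
    Δ.map (Prod.map f id) = Δ := by
  conv_rhs => rw [← Multiset.map_id Δ]
  exact Multiset.map_congr rfl fun p hp => Prod.ext (h p.1 ⟨p.2, hp⟩) rfl

theorem Tree.alphaEq (hS : S.WF) {Δ : Ctx Lab TN} {K : Chan × Ty Lab TN}
    {D D' : Config Lab TN ar} (h : Tree S Δ K D) (ha : AlphaEq Δ K D D') : Tree S Δ K D' := by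
  obtain ⟨ρ, hρ, rfl⟩ := ha
  rw [tree_iff hS] at h ⊢
  obtain ⟨h₁, h₂⟩ := h
  set f : Chan → Chan := fun c => ⟨ρ c.base, c.gen⟩ with hf
  have hi : Function.Injective f := by
    rintro ⟨b, g⟩ ⟨b', g'⟩ h
    simp only [hf, Chan.mk.injEq, EmbeddingLike.apply_eq_iff_eq] at h
    rw [h.1, h.2]
  have hfix : ∀ c ∈ iface Δ K, f c = c := by
    rintro ⟨b, g⟩ hc
    simp only [hf, hρ _ hc]
  have hΔ := map_fixed (Δ := K ::ₘ Δ) (f := f) hfix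
  rw [Multiset.map_cons] at hΔ
  have hK : Prod.map f id K = K := Prod.ext (hfix K.1 (Ctx.mem_dom_cons.2 (.inl rfl))) rfl
  rw [hK, Multiset.cons_inj_right] at hΔ
  have h₃ := h₁.map (f := f) (fun _ => rfl) hi
  have h₄ := chansOf_map (f := f) (fun _ => rfl) Δ D
  rw [hΔ, Multiset.map_singleton, hK] at h₃
  rw [hΔ] at h₄
  refine ⟨h₃, ?_⟩
  rw [h₄]
  rintro _ ⟨c, hc, rfl⟩ _ ⟨c', hc', rfl⟩ hb hg
  exact linkedChans_map (h₂ c hc c' hc' (ρ.injective hb) hg)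

theorem Tree.steps (hS : S.WF) {Δ : Ctx Lab TN} {K : Chan × Ty Lab TN}
    {D D' : Config Lab TN ar} (h : Tree S Δ K D) (hs : Steps S Δ K D D') : Tree S Δ K D' := by
  obtain ⟨D'', hs, ha⟩ := hs
  refine Tree.alphaEq hS ?_ ha
  clear ha
  rw [tree_iff hS] at h ⊢
  have hN : Ctx.dom Δ ⊆ iface Δ K := fun c hc => Ctx.mem_dom_cons.2 (.inr hc)
  induction hs with
  | refl => exact h
  | tail _ hs ih => exact hs.preserve hS hN ih.1 ih.2

/-! ### Messages on the interface -/

theorem SeqTyped.conv_single {Δ : Ctx Lab TN} {C : Config Lab TN ar} {x : Chan}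
    {A B : Ty Lab TN} (h : SeqTyped S Δ C {(x, A)}) (hAB : TyEq S A B) :
    SeqTyped S Δ C {(x, B)} :=
  .conv h (CtxEq.cons hAB .zero)

theorem SeqTyped.conv_left (hS : S.WF) {Δ Δ' : Ctx Lab TN} {C : Config Lab TN ar} {x : Chan}
    {A B : Ty Lab TN} (h : SeqTyped S ((x, A) ::ₘ Δ) C Δ') (hBA : TyEq S B A) :
    SeqTyped S ((x, B) ::ₘ Δ) C Δ' := by
  have he : CtxEq S ((x, B) ::ₘ Δ) ((x, A) ::ₘ Δ) := CtxEq.cons hBA (.refl hS Δ)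
  have h₁ : SeqTyped S ((x, B) ::ₘ Δ) (0 : Config Lab TN ar) ((x, A) ::ₘ Δ) :=
    .conv (.id (he.symm.linear h.linear_left)) he
  have := h₁.comp h fun c hc _ => by
    rw [← he.dom]
    exact hc.resolve_right not_mem_chans_zero
  rwa [zero_add] at this

theorem chansOf_cons (x : Chan) (A B : Ty Lab TN) (Δ : Ctx Lab TN) (C : Config Lab TN ar) :
    chansOf ((x, A) ::ₘ Δ) C = chansOf ((x, B) ::ₘ Δ) C := by
  simp [chansOf, Ctx.dom_cons]

/-- A message sent along the provided channel is the root of the tree. -/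
theorem SeqTyped.root_msg (hS : S.WF) {Δ : Ctx Lab TN} {C : Config Lab TN ar} {y : Chan}
    {T : Ty Lab TN} {M : Msg Lab} (h : SeqTyped S Δ (.msg M ::ₘ C) {(y, T)})
    (hM : M.carrier = y) :
    ∃ Ω, SeqTyped S Δ C Ω ∧ MTyped S Ω M y T ∧ y ∉ chansOf Δ C := by
  obtain @⟨C₁, C₂, Ω, Γ, x, A, rfl, h₁, hn, hx, h₂, hd⟩ := h.cut
  have hyM : y ∈ (Node.msg M : Node Lab TN ar).chans := hM ▸ M.carrier_mem
  have hs₁ := h₁.dom_subset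
  have hl := (Ctx.linear_add.1 h₁.linear_right).2.2
  obtain rfl : y = x := by
    by_contra hyx
    have hyΩ := (hn.chans_subset y hyM).resolve_left hyx
    have := hd y (.inr (mem_chans_cons.2 (.inl hyM)))
      (h₂.dom_subset y (Ctx.mem_dom_singleton.2 rfl))
    exact hl y hyΩ ((Ctx.mem_dom_cons.1 this).resolve_left hyx)
  obtain ⟨hT, h₃, -⟩ := SeqTyped.unframe (Δ := 0) h₂ hS
  obtain ⟨rfl, rfl⟩ := h₃.eq_zero rfl
  rw [add_zero] at h₁
  rw [add_zero]
  cases hn with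
  | msg hn => exact ⟨Ω, h₁, hn.tyEq hS hT, hx⟩

/-- A message sent along a used channel `y` separates the tree into the part feeding the message
and the part using `y.next`. -/
theorem SeqTyped.leaf_msg (hS : S.WF) {Δ : Ctx Lab TN} {K : Chan × Ty Lab TN}
    {C : Config Lab TN ar} {y : Chan} {T : Ty Lab TN} {M : Msg Lab}
    (h : SeqTyped S ((y, T) ::ₘ Δ) (.msg M ::ₘ C) {K}) (hM : M.carrier = y) :
    ∃ Δa Δb Ca Cb Ω A T', Δ = Δa + Δb ∧ C = Ca + Cb ∧ SeqTyped S Δa Ca Ω ∧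
      SeqTyped S ((y.next, A) ::ₘ Δb) Cb {K} ∧ TyEq S T T' ∧
      MTyped S ((y, T') ::ₘ Ω) M y.next A ∧ y ∉ Ctx.dom Ω ∧
      Disjoint (chansOf Δa Ca) (chansOf ((y.next, A) ::ₘ Δb) Cb) ∧ y ∉ chansOf Δa Ca ∧
      y ∉ chansOf ((y.next, A) ::ₘ Δb) Cb := by
  obtain @⟨C₁, C₂, Ω, Γ, x, A, rfl, h₁, hn, hx, h₂, hd⟩ := h.cut
  have hyM : y ∈ (Node.msg M : Node Lab TN ar).chans := hM ▸ M.carrier_mem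
  have hyx : y ≠ x := fun hyx => hx (hyx ▸ .inl (Ctx.mem_dom_cons.2 (.inl rfl)))
  have hyΩ := (hn.chans_subset y hyM).resolve_left hyx
  obtain ⟨T', Ω, rfl⟩ := Ctx.exists_cons_of_mem_dom hyΩ
  have hl := h₁.linear_right
  rw [Multiset.cons_add] at h₁ hl
  obtain ⟨hT, h₁', hy₁⟩ := h₁.unframe hS
  have hy' := (Ctx.linear_cons.1 hl).1
  have hyΩ' : y ∉ Ctx.dom Ω := fun hc => hy' (Ctx.mem_dom_add.2 (.inl hc))
  obtain ⟨Δa, Δb, Ca, Cb, rfl, rfl, ha, hb, hab⟩ := h₁'.split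
  cases hn with
  | msg hn =>
    obtain rfl := (hn.carrier_left hM hyΩ' hyx).1
    have hfr : ∀ c ∈ Ctx.dom {(y.next, A)}, c ∉ chansOf Δb Cb := by
      intro c hc
      rw [Ctx.mem_dom_singleton] at hc
      simp only [mem_chansOf, mem_chans_add, Ctx.mem_dom_cons, Ctx.mem_dom_add] at *
      grind
    have h₃ := hb.frame hS (Ctx.linear_singleton (y.next, A)) hfr
    rw [add_comm Δb, add_comm Γ, Multiset.singleton_add, Multiset.singleton_add] at h₃
    have hsb := hb.dom_subset
    rw [Set.disjoint_left] at hab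
    refine ⟨Δa, Δb, Ca, Cb + C₂, Ω, A, T', rfl, add_assoc _ _ _, ha, h₃.comp h₂ ?_, hT, hn,
      hyΩ', Set.disjoint_left.2 ?_, ?_, ?_⟩ <;>
      simp only [mem_chansOf, mem_chans_cons, mem_chans_add, Ctx.mem_dom_cons,
        Ctx.mem_dom_add] at * <;> grind

/-- A message put below a used channel `y`, providing it. -/
theorem SeqTyped.graft {Γ Δ : Ctx Lab TN} {K : Chan × Ty Lab TN} {D : Config Lab TN ar}
    {n : Node Lab TN ar} {y : Chan} {T : Ty Lab TN} (hn : NTyped S Γ n y T)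
    (h : SeqTyped S ((y, T) ::ₘ Δ) D {K}) (hΓ : Ctx.Linear Γ)
    (hd : ∀ c ∈ Ctx.dom Γ, c ∉ chansOf ((y, T) ::ₘ Δ) D) :
    SeqTyped S (Γ + Δ) (n ::ₘ D) {K} := by
  have hl := Ctx.linear_cons.1 h.linear_left
  have hc := hn.chans_subset
  have h₁ : SeqTyped S (Γ + Δ) 0 (Γ + Δ) := .id (Ctx.linear_add.2 ⟨hΓ, hl.2, fun c hc hc' =>
    hd c hc (.inl (Ctx.mem_dom_cons.2 (.inr hc')))⟩)
  have h₂ := (h₁.cons hn (by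
    simp only [mem_chansOf, not_mem_chans_zero, Ctx.mem_dom_cons, Ctx.mem_dom_add] at *
    grind)).comp h (by
    simp only [mem_chansOf, mem_chans_cons, not_mem_chans_zero, Ctx.mem_dom_cons,
      Ctx.mem_dom_add] at *
    grind)
  rwa [Multiset.cons_add, zero_add] at h₂

/-! ### The value relations -/

/-- The diagonal of the sending clauses: a message sent along an interface channel is taken off,
and the remaining parts are trees. -/
theorem Tree.vSend (hS : S.WF)
    {E : Ctx Lab TN → Chan × Ty Lab TN → Config Lab TN ar → Config Lab TN ar → Prop}
    (hE : ∀ Δ K D, Tree S Δ K D → E Δ K D D) {Δ : Ctx Lab TN} {K : Chan × Ty Lab TN}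
    {D : Config Lab TN ar} {y : Chan} (hD : Tree S Δ K D) (hy : y ∈ Outs S Δ K)
    (hr : y ∈ sendReady Δ K D) : VSend S E Δ K y D D := by
  obtain ⟨h, hg⟩ := (tree_iff hS).1 hD
  obtain ⟨-, M, hMD, hM⟩ := hr
  obtain ⟨C, rfl⟩ := Multiset.exists_cons_of_mem hMD
  -- A subtree inherits the naming convention if it contains the links of its own channels.
  have sub : ∀ {N' L' : Set Chan}, (∀ c ∈ N', c ∈ chansOf Δ (.msg M ::ₘ C)) → y ∉ N' →
      (∀ c ∈ N', c ∈ linkedChans C → c ∈ L') → GenLinked N' L' := by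
    intro N' L' h₁ h₂ h₃
    refine hg.mono h₁ fun c hc hc' => h₃ c hc ?_
    rw [linkedChans_cons_msg] at hc'
    exact hc'.resolve_left fun hc' => h₂ ((hc'.carrier_eq.symm.trans hM) ▸ hc)
  rcases hy with ⟨rfl, -⟩ | ⟨T, hT, -⟩
  · obtain ⟨y, T⟩ := K
    obtain ⟨Ω, h₁, hMT, hy⟩ := h.root_msg hS hM
    cases M with
    | close y' =>
      obtain rfl : y' = y := hM
      obtain ⟨rfl, -, hT⟩ := hMT.close_inv
      obtain ⟨rfl, rfl⟩ := h₁.eq_zero rfl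
      exact .oneR hT.unfold_one hD
    | lab y' k =>
      obtain rfl : y' = y := hM
      obtain ⟨L, B, U, rfl, hk, hT, hU⟩ := hMT.lab_inv rfl
      obtain ⟨A, hA, hAB⟩ := hT.exists_plus
      refine .plusR hA hk hD hD (hE _ _ _ ((tree_iff hS).2
        ⟨h₁.conv_single (hU.trans (hAB k hk).symm), sub ?_ hy fun _ _ => id⟩))
      simp only [mem_chansOf, mem_chans_cons]
      grind
    | send z y' =>
      obtain rfl : y' = y := hM
      obtain ⟨B, B', rfl, hT⟩ := hMT.send_inv rfl
      obtain ⟨A, A', hA, hAB, hAB'⟩ := hT.exists_tensor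
      obtain ⟨Δa, Δb, Ca, Cb, rfl, rfl, ha, hb, hab⟩ :=
        SeqTyped.split (Δa := {(z, B)}) (Δb := {(y'.next, B')}) h₁
      rw [chansOf_add] at hy
      rw [add_comm Ca, add_comm Δa] at hD ⊢
      rw [Set.disjoint_left] at hab
      have hta : Tree S Δa (z, A) Ca := by
        refine (tree_iff hS).2 ⟨ha.conv_single hAB.symm, sub ?_ (fun hc => hy (.inl hc)) ?_⟩
        · simp only [mem_chansOf, mem_chans_cons, mem_chans_add, Ctx.mem_dom_add]
          grind
        · intro c hc hc'
          rw [linkedChans_add] at hc'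
          exact hc'.resolve_right fun hc' => hab hc (.inr (linkedChans_subset hc'))
      have htb : Tree S Δb (y'.next, A') Cb := by
        refine (tree_iff hS).2 ⟨hb.conv_single hAB'.symm, sub ?_ (fun hc => hy (.inr hc)) ?_⟩
        · simp only [mem_chansOf, mem_chans_cons, mem_chans_add, Ctx.mem_dom_add]
          grind
        · intro c hc hc'
          rw [linkedChans_add] at hc'
          exact hc'.resolve_left fun hc' => hab (.inr (linkedChans_subset hc')) hc
      exact .tensorR hA hD hD hta hta (hE _ _ _ hta) (hE _ _ _ htb)
  · obtain ⟨Δ, rfl⟩ := Multiset.exists_cons_of_mem hT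
    obtain ⟨Δa, Δb, Ca, Cb, Ω, A, T', rfl, rfl, ha, hb, hTT, hMT, hyΩ, hab, hya, hyb⟩ :=
      h.leaf_msg hS hM
    have hnM : y.next ∈ (Node.msg M : Node Lab TN ar).chans := (NTyped.msg hMT).mem_chans
    have hsub : ∀ c ∈ chansOf ((y.next, A) ::ₘ Δb) Cb,
        c ∈ chansOf ((y, T) ::ₘ (Δa + Δb)) (.msg M ::ₘ (Ca + Cb)) := by
      simp only [mem_chansOf, mem_chans_cons, mem_chans_add, Ctx.mem_dom_cons, Ctx.mem_dom_add]
      grind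
    rw [Set.disjoint_left] at hab
    have hlb : ∀ c ∈ chansOf ((y.next, A) ::ₘ Δb) Cb, c ∈ linkedChans (Ca + Cb) →
        c ∈ linkedChans Cb := by
      intro c hc hc'
      rw [linkedChans_add] at hc'
      exact hc'.resolve_left fun hc' => hab (.inr (linkedChans_subset hc')) hc
    have htb : ∀ {B}, TyEq S B A → Tree S ((y.next, B) ::ₘ Δb) K Cb := fun {B} hB =>
      (tree_iff hS).2 ⟨hb.conv_left hS hB, by
        rw [chansOf_cons _ B A]
        exact sub hsub hyb hlb⟩
    rcases (hMT.carrier_left hM hyΩ (Chan.next_ne y).symm).2 with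
      ⟨k, L, B, rfl, rfl, hk, hT', hA⟩ | ⟨z, B, rfl, rfl, hT'⟩
    · obtain ⟨rfl, rfl⟩ := ha.eq_zero rfl
      obtain ⟨A', hA', hAB⟩ := (hTT.trans hT').exists_amp
      simp only [zero_add] at hD ⊢
      exact .ampL hA' hk hD hD (hE _ _ _ (htb ((hAB k hk).trans hA.symm)))
    · obtain ⟨B', A', hA', hBB, hAA⟩ := (hTT.trans hT').exists_lolli
      have hta : Tree S Δa (z, B') Ca := by
        refine (tree_iff hS).2 ⟨ha.conv_single hBB.symm, sub ?_ hya ?_⟩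
        · simp only [mem_chansOf, mem_chans_cons, mem_chans_add, Ctx.mem_dom_cons,
            Ctx.mem_dom_add]
          grind
        · intro c hc hc'
          rw [linkedChans_add] at hc'
          exact hc'.resolve_right fun hc' => hab hc (.inr (linkedChans_subset hc'))
      exact .lolliL hA' hD hD hta hta (hE _ _ _ hta) (hE _ _ _ (htb hAA))

/-- The diagonal of the receiving clauses: adding the message for which a process waits gives a
tree. That a process waits is needed for the naming convention: otherwise the next generation of
`y` could occur already. -/
theorem Tree.vRecv (hS : S.WF)
    {E : Ctx Lab TN → Chan × Ty Lab TN → Config Lab TN ar → Config Lab TN ar → Prop}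
    (hE : ∀ Δ K D, Tree S Δ K D → E Δ K D D) {Δ : Ctx Lab TN} {K : Chan × Ty Lab TN}
    {D : Config Lab TN ar} {y : Chan} (hD : Tree S Δ K D) (hy : y ∈ Ins S Δ K)
    (hr : y ∈ recvReady Δ K D) : VRecv S E Δ K y D D := by
  obtain ⟨h, hg⟩ := (tree_iff hS).1 hD
  have hl := h.not_linked_of_waits hS hr
  have hs := h.dom_subset
  have hyN : y ∈ chansOf Δ D := by
    rcases Ctx.mem_dom_cons.1 hr.1 with rfl | h
    · exact hs _ (Ctx.mem_dom_singleton.2 rfl)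
    · exact .inl h
  -- As `y` is not linked yet, its next generation is unused.
  have hnext := hg.next_not_mem hyN hl
  have fresh : ∀ {x : Chan}, FreshFor x Δ K D D → ∀ c ∈ chansOf Δ D, c.base ≠ x.base := by
    rintro x hx c (hc | hc)
    · exact hx c (.inl (.inl (Ctx.mem_dom_cons.2 (.inr hc))))
    · exact hx c (.inr hc)
  have hxn : ∀ {x : Chan}, FreshFor x Δ K D D → x ∉ chansOf Δ D ∧ x ≠ y ∧ x ≠ y.next :=
    fun hx => ⟨fun hc => fresh hx _ hc rfl, fun hc => fresh hx _ hyN (hc ▸ rfl),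
      fun hc => fresh hx _ hyN (hc ▸ rfl)⟩
  have gen : ∀ {M : Msg Lab} {N' : Set Chan}, M.Links y →
      (∀ c ∈ N', c = y.next ∨ c ∈ chansOf Δ D) →
      GenLinked N' (linkedChans (.msg M ::ₘ D)) := by
    intro M N' hM hN'
    refine (hg.insert_next hyN hl).mono hN' fun c _ hc => ?_
    rw [linkedChans_cons_msg]
    rcases hc with rfl | hc
    · exact .inl hM
    · exact .inr hc
  have gen' : ∀ {M : Msg Lab} {N' : Set Chan} {x : Chan}, FreshFor x Δ K D D → M.Links y →
      (∀ c ∈ N', c = x ∨ c = y.next ∨ c ∈ chansOf Δ D) →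
      GenLinked N' (linkedChans (.msg M ::ₘ D)) := by
    intro M N' x hx hM hN'
    refine ((hg.insert_next hyN hl).insert_fresh (x := x) ?_).mono hN' fun c _ hc => ?_
    · rintro c (rfl | hc)
      · exact fresh hx y hyN
      · exact fresh hx c hc
    rw [linkedChans_cons_msg]
    rcases hc with rfl | hc
    · exact .inl hM
    · exact .inr hc
  rcases hy with ⟨rfl, hneg⟩ | ⟨T, hT, hpos⟩
  · obtain ⟨y, T⟩ := K
    rcases hneg with ⟨L, A, hT⟩ | ⟨A, B, hT⟩
    · refine .ampR hT hD hD fun k hk => hE _ _ _ ((tree_iff hS).2 ⟨?_, gen (.inl ⟨k, rfl⟩) ?_⟩)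
      · refine .cons (Ω := {(y, T)}) (Δ := 0) h (.msg (.ampL (.of_unfold_eq hS hT)
          (.refl hS _) hk)) hnext
      · simp only [mem_chansOf, mem_chans_cons, Node.chans, Msg.chans, Set.mem_insert_iff,
          Set.mem_singleton_iff] at *
        grind
    · refine .lolliR hT hD hD fun x hx => hE _ _ _ ((tree_iff hS).2
        ⟨?_, gen' hx (.inr ⟨x, rfl⟩) ?_⟩)
      · have h₁ := h.frame hS (Ctx.linear_singleton (x, A)) fun c hc => by
          rw [Ctx.mem_dom_singleton] at hc
          exact hc ▸ (hxn hx).1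
        rw [add_comm Δ, add_comm {(y, T)}, Multiset.singleton_add] at h₁
        refine .cons (Ω := {(x, A), (y, T)}) (Δ := 0) (by rw [add_zero]; exact h₁)
          (.msg (.lolliL (.of_unfold_eq hS hT))) ?_
        have := hxn hx
        simp only [mem_chansOf, Ctx.mem_dom_cons] at *
        grind
      · simp only [mem_chansOf, mem_chans_cons, Node.chans, Msg.chans, Set.mem_insert_iff,
          Set.mem_singleton_iff, Ctx.mem_dom_cons] at *
        grind
  · obtain ⟨Δ, rfl⟩ := Multiset.exists_cons_of_mem hT
    rcases hpos with hT | ⟨L, A, hT⟩ | ⟨A, B, hT⟩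
    · refine .oneL hT hD hD (hE _ _ _ ((tree_iff hS).2 ⟨?_, ?_⟩))
      · have := SeqTyped.graft (.msg (.oneR (.of_unfold_eq hS hT))) h Ctx.linear_zero
          fun c hc => absurd hc Ctx.not_mem_dom_zero
        rwa [zero_add] at this
      · refine hg.mono ?_ fun c _ hc => ?_
        · simp only [mem_chansOf, mem_chans_cons, Node.chans, Msg.chans,
            Set.mem_singleton_iff, Ctx.mem_dom_cons] at *
          grind
        · rw [linkedChans_cons_msg]
          exact .inr hc
    · refine .plusL hT hD hD fun k hk => hE _ _ _ ((tree_iff hS).2 ⟨?_, gen (.inl ⟨k, rfl⟩) ?_⟩)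
      · exact SeqTyped.graft (.msg (.plusR (.of_unfold_eq hS hT) (.refl hS _) hk)) h
          (Ctx.linear_singleton _) fun c hc => by
            rw [Ctx.mem_dom_singleton] at hc
            exact hc ▸ hnext
      · simp only [mem_chansOf, mem_chans_cons, Node.chans, Msg.chans, Set.mem_insert_iff,
          Set.mem_singleton_iff, Ctx.mem_dom_cons] at *
        grind
    · refine .tensorL hT hD hD fun x hx => hE _ _ _ ((tree_iff hS).2
        ⟨?_, gen' hx (.inr ⟨x, rfl⟩) ?_⟩)
      · have h₁ := SeqTyped.graft (.msg (.tensorR (z := x) (.of_unfold_eq hS hT))) h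
          (by
            rw [Multiset.insert_eq_cons, Ctx.linear_cons, Ctx.mem_dom_singleton]
            exact ⟨(hxn hx).2.2, Ctx.linear_singleton _⟩)
          fun c hc => by
            rw [Multiset.insert_eq_cons, Ctx.mem_dom_cons, Ctx.mem_dom_singleton] at hc
            rcases hc with rfl | rfl
            · exact (hxn hx).1
            · exact hnext
        simpa [Multiset.insert_eq_cons] using h₁
      · simp only [mem_chansOf, mem_chans_cons, Node.chans, Msg.chans, Set.mem_insert_iff,
          Set.mem_singleton_iff, Ctx.mem_dom_cons] at *
        grind

theorem Tree.eRel (hS : S.WF) (m : ℕ) (Δ : Ctx Lab TN) (K : Chan × Ty Lab TN)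
    (D : Config Lab TN ar) (hD : Tree S Δ K D) : ERel S m Δ K D D := by
  induction m generalizing Δ K D with
  | zero => exact ⟨hD, hD⟩
  | succ m ih =>
    refine ⟨⟨hD, hD⟩, fun D' hs => ⟨D', hs, subset_rfl, fun y hy hr => ?_, fun y hy hr => ?_⟩⟩
    · exact (hD.steps hS hs).vSend hS ih hy hr
    · exact (hD.steps hS hs).vRecv hS ih hy hr

end

end RSLR

theorem mainTheorem6 {Lab TN PN : Type} {ar : PN → ℕ} (S : RSLR.Sig Lab TN ar) (hS : S.WF)
    (Δ : RSLR.Ctx Lab TN) (D : RSLR.Config Lab TN ar) (x : RSLR.Chan) (T : RSLR.Ty Lab TN)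
    (hD : RSLR.CTyped S Δ D {(x, T)}) (hN : RSLR.WellNamed Δ (x, T) D) :
    RSLR.LogEquiv S Δ (x, T) D D := by
  have hT : RSLR.Tree S Δ (x, T) D := ⟨hD, hN⟩
  exact ⟨⟨hT, hT⟩, fun m => hT.eRel hS m, fun m => hT.eRel hS m⟩
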